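/- Let $A$ be a (commutative) local ring and let $\Phi=\mathsf A_\ell$ with $n=\ell+1\ge 4$ (so $n=4$ is included). Realize $\Phi$ as the set of vectors $\varepsilon_i-\varepsilon_j$, $1\le i\neq j\le n$, in $\mathbb R^n$ with standard basis $\varepsilon_1,\dots,\varepsilon_n$, write $\langle v,\alpha\rangle=2(v,\alpha)/(\alpha,\alpha)$ for $\alpha\in\Phi$, and let $\varpi_1=\varepsilon_1-\frac1{\ell+1}(\varepsilon_1+\dots+\varepsilon_n)$ be the first fundamental weight. For a commutative ring $R$ let $\mathrm{St}(\mathsf A_\ell,R)=\mathrm{St}(n,R)$ be the linear Steinberg group, i.e. the group with generators $x_\alpha(a)$ ($\alpha\in\Phi$, $a\in R$; write $x_{ij}$ for $x_{\varepsilon_i-\varepsilon_j}$) and relations $x_{ij}(a)x_{ij}(b)=x_{ij}(a+b)$, $[x_{ij}(a),x_{jk}(b)]=x_{ik}(ab)$ for $i\ne k$, and $[x_{ij}(a),x_{kl}(b)]=1$ for $j\neq k$, $i\ne l$, where $[g,h]=ghg^{-1}h^{-1}$. For a weight $\omega$ in the weight lattice of $\Phi$ let $\mathcal X_\omega$ be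 the set of those generators $x_\alpha(f)$ of $\mathrm{St}(\Phi,A[X])$ for which $\langle\omega,\alpha\rangle<0$ implies that $X^{-\langle\omega,\alpha\rangle}$ divides $f$, and let $N_\omega\le\mathrm{St}(\Phi,A[X])$ be the subgroup generated by $\mathcal X_\omega$. An $\omega$-pair is a pair of mutually inverse group homomorphisms $\sigma(\omega)\colon N_\omega\to N_{-\omega}$ and $\sigma(-\omega)\colon N_{-\omega}\to N_\omega$ such that $$\sigma(\pm\omega)(x_\alpha(f))=x_\alpha\bigl(X^{\pm\langle\omega,\alpha\rangle}f\bigr)\quad\text{for all } x_\alpha(f)\in\mathcal X_{\pm\omega}.$$ Then there exists a $\varpi_1$-pair. -/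

import Mathlib

open scoped Polynomial LaurentPolynomial commutatorElement

noncomputable section

namespace TypeA

/-! ### The root system of type `A_ℓ` and its weights -/

/-- The roots of `A_ℓ`: the ordered pairs `(i, j)` of distinct indices from `{0, …, ℓ}`.
The pair `(i, j)` stands for the vector `ε_i - ε_j`, see `Root.vec`. -/
@[ext]
structure Root (ℓ : ℕ) where
  i : Fin (ℓ + 1)
  j : Fin (ℓ + 1)
  ne : i ≠ j

/-- The root `(i, j)` as the vector `ε_i - ε_j` of the Euclidean space `ℝ^(ℓ+1)`. -/
def Root.vec {ℓ : ℕ} (α : Root ℓ) : EuclideanSpace ℝ (Fin (ℓ + 1)) :=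
  EuclideanSpace.single α.i (1 : ℝ) - EuclideanSpace.single α.j (1 : ℝ)

/-- The coroot `α^∨ = 2 / (α, α) • α`. -/
def Root.covec {ℓ : ℕ} (α : Root ℓ) : EuclideanSpace ℝ (Fin (ℓ + 1)) :=
  (2 / inner ℝ α.vec α.vec) • α.vec

/-- The simple root `α_{k+1} = ε_k - ε_{k+1}` (the simple roots are numbered from `0` here). -/
def simpleRoot {ℓ : ℕ} (k : Fin ℓ) : Root ℓ :=
  ⟨k.castSucc, k.succ, Fin.castSucc_lt_succ.ne⟩

/-- The fundamental weight with number `k`, counted from `0` (so `k = 0` gives `ϖ₁`):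
`ϖ_{k+1} = ε_0 + ⋯ + ε_k - (k+1)/(ℓ+1) • (ε_0 + ⋯ + ε_ℓ)`. -/
def fundamentalWeightVec {ℓ : ℕ} (k : Fin ℓ) : EuclideanSpace ℝ (Fin (ℓ + 1)) :=
  WithLp.toLp 2 fun i : Fin (ℓ + 1) =>
    (if (i : ℕ) ≤ (k : ℕ) then (1 : ℝ) else 0) - ((k : ℝ) + 1) / ((ℓ : ℝ) + 1)

/-- The weight lattice `P(A_ℓ)`, spanned over `ℤ` by the fundamental weights. -/
def weightLattice (ℓ : ℕ) : AddSubgroup (EuclideanSpace ℝ (Fin (ℓ + 1))) :=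
  AddSubgroup.closure (Set.range (fundamentalWeightVec (ℓ := ℓ)))

/-- The fundamental weight with number `k`, counted from `0`, as an element of `P(A_ℓ)`. -/
def fundamentalWeight {ℓ : ℕ} (k : Fin ℓ) : weightLattice ℓ :=
  ⟨fundamentalWeightVec k, AddSubgroup.subset_closure ⟨k, rfl⟩⟩

theorem inner_covec {ℓ : ℕ} (v : EuclideanSpace ℝ (Fin (ℓ + 1))) (α : Root ℓ) :
    inner ℝ v α.covec = v α.i - v α.j := by
  have h1 := α.ne
  have h2 := α.ne.symm
  have h : inner ℝ α.vec α.vec = (2 : ℝ) := by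
    rw [Root.vec, inner_sub_left, inner_sub_right, inner_sub_right]
    simp [EuclideanSpace.inner_single_left, h1, h2]
    norm_num
  rw [Root.covec, h]
  simp [Root.vec, inner_sub_right, EuclideanSpace.inner_single_right]

/-- The fundamental weights are dual to the simple coroots. -/
theorem inner_fundamentalWeightVec {ℓ : ℕ} (k m : Fin ℓ) :
    inner ℝ (fundamentalWeightVec k) (simpleRoot m).covec = if k = m then (1 : ℝ) else 0 := by
  rw [inner_covec]
  simp only [fundamentalWeightVec, simpleRoot, Fin.val_castSucc, Fin.val_succ, Fin.ext_iff]
  split_ifs <;> first | omega | simp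

theorem exists_inner_covec_eq {ℓ : ℕ} (ω : weightLattice ℓ) (α : Root ℓ) :
    ∃ m : ℤ, inner ℝ (ω : EuclideanSpace ℝ (Fin (ℓ + 1))) α.covec = (m : ℝ) := by
  obtain ⟨ω, hω⟩ := ω
  simp only [inner_covec]
  induction hω using AddSubgroup.closure_induction with
  | mem v hv =>
    obtain ⟨k, rfl⟩ := hv
    refine ⟨(if (α.i : ℕ) ≤ k then 1 else 0) - (if (α.j : ℕ) ≤ k then 1 else 0), ?_⟩
    simp [fundamentalWeightVec]
  | zero => exact ⟨0, by simp⟩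
  | add v w _ _ hv hw =>
    obtain ⟨a, ha⟩ := hv
    obtain ⟨b, hb⟩ := hw
    refine ⟨a + b, ?_⟩
    push_cast
    rw [← ha, ← hb]
    simp only [PiLp.add_apply]
    ring
  | neg v _ hv =>
    obtain ⟨a, ha⟩ := hv
    refine ⟨-a, ?_⟩
    push_cast
    rw [← ha]
    simp only [PiLp.neg_apply]
    ring

/-- The integer `⟨ω, α⟩ = (ω, α^∨)`, for a weight `ω` and a root `α`
(the floor only changes the type, see `pairing_spec`). -/
def pairing {ℓ : ℕ} (ω : weightLattice ℓ) (α : Root ℓ) : ℤ :=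
  ⌊(inner ℝ (ω : EuclideanSpace ℝ (Fin (ℓ + 1))) α.covec : ℝ)⌋

theorem pairing_spec {ℓ : ℕ} (ω : weightLattice ℓ) (α : Root ℓ) :
    (pairing ω α : ℝ) = inner ℝ (ω : EuclideanSpace ℝ (Fin (ℓ + 1))) α.covec := by
  obtain ⟨m, hm⟩ := exists_inner_covec_eq ω α
  rw [pairing, hm, Int.floor_intCast]

/-! ### The Steinberg group `St(A_ℓ, R) = St(ℓ + 1, R)` -/

/-- The defining relators of the linear Steinberg group in the generators `x_α(a)`.
For `α = ε_i - ε_j` and `β = ε_k - ε_l` the condition `α + β ∉ Φ ∪ {0}` says that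
`j ≠ k` and `i ≠ l`. In `comm_add` the sum of the two roots is the root `ε_i - ε_k` and the structure
constant is `1`; for the two roots in the opposite order it is `-1`, and that relator is obtained
from `comm_add` by taking the inverse. -/
inductive SteinbergRel (ℓ : ℕ) (R : Type*) [CommRing R] : FreeGroup (Root ℓ × R) → Prop
  | add (α : Root ℓ) (a b : R) :
      SteinbergRel ℓ R
        (FreeGroup.of (α, a) * FreeGroup.of (α, b) * (FreeGroup.of (α, a + b))⁻¹)
  | comm_add (i j k : Fin (ℓ + 1)) (hij : i ≠ j) (hjk : j ≠ k) (hik : i ≠ k) (a b : R) :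
      SteinbergRel ℓ R
        (⁅FreeGroup.of ((⟨i, j, hij⟩ : Root ℓ), a), FreeGroup.of ((⟨j, k, hjk⟩ : Root ℓ), b)⁆ *
          (FreeGroup.of ((⟨i, k, hik⟩ : Root ℓ), a * b))⁻¹)
  | comm_one (α β : Root ℓ) (h₁ : α.j ≠ β.i) (h₂ : α.i ≠ β.j) (a b : R) :
      SteinbergRel ℓ R ⁅FreeGroup.of (α, a), FreeGroup.of (β, b)⁆

/-- The Steinberg group `St(A_ℓ, R) = St(ℓ + 1, R)`, by generators and relations. -/
abbrev Steinberg (ℓ : ℕ) (R : Type*) [CommRing R] : Type _ :=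
  PresentedGroup {r | SteinbergRel ℓ R r}

/-- The generator `x_α(a)` of the Steinberg group. -/
def Steinberg.x {ℓ : ℕ} {R : Type*} [CommRing R] (α : Root ℓ) (a : R) : Steinberg ℓ R :=
  PresentedGroup.of (α, a)

/-! ### The subgroups `N_ω` and `ω`-pairs -/

/-- `x_α(f)` belongs to the generating set of `N_ω`: if `⟨ω, α⟩ < 0`, then `f` is divisible by
`X ^ (-⟨ω, α⟩)`. -/
def Admissible {ℓ : ℕ} {A : Type*} [CommRing A] (ω : weightLattice ℓ) (α : Root ℓ)
    (f : A[X]) : Prop :=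
  pairing ω α < 0 → Polynomial.X ^ (-pairing ω α).toNat ∣ f

/-- The subgroup `N_ω` of `St(A_ℓ, A[X])`, generated by the admissible `x_α(f)`. -/
def N {ℓ : ℕ} (A : Type*) [CommRing A] (ω : weightLattice ℓ) : Subgroup (Steinberg ℓ A[X]) :=
  Subgroup.closure {g | ∃ (α : Root ℓ) (f : A[X]), Admissible ω α f ∧ g = Steinberg.x α f}

theorem x_mem_N {ℓ : ℕ} {A : Type*} [CommRing A] {ω : weightLattice ℓ} {α : Root ℓ} {f : A[X]}
    (h : Admissible ω α f) : Steinberg.x α f ∈ N A ω :=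
  Subgroup.subset_closure ⟨α, f, h, rfl⟩

/-- The polynomial `X ^ p * f` for an integer `p`; for `p < 0` it is used only if `f` is divisible
by `X ^ (-p)`, see `toLaurent_shift`. -/
def shift {A : Type*} [CommRing A] (p : ℤ) (f : A[X]) : A[X] :=
  (Polynomial.X ^ p.toNat * f) /ₘ Polynomial.X ^ (-p).toNat

/-- If `p ≥ 0` or `X ^ (-p)` divides `f`, then `shift p f` is the product `X ^ p * f` taken in
the ring of Laurent polynomials. -/
theorem toLaurent_shift {A : Type*} [CommRing A] (p : ℤ) (f : A[X])
    (h : p < 0 → Polynomial.X ^ (-p).toNat ∣ f) :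
    Polynomial.toLaurent (shift p f) = LaurentPolynomial.T p * Polynomial.toLaurent f := by
  unfold shift
  rcases lt_or_ge p 0 with hp | hp
  · obtain ⟨g, rfl⟩ := h hp
    have h0 : p.toNat = 0 := by omega
    rw [h0, pow_zero, one_mul, Polynomial.mul_divByMonic_cancel_left _ (Polynomial.monic_X_pow _),
      map_mul, Polynomial.toLaurent_X_pow, ← mul_assoc, ← LaurentPolynomial.T_add]
    have : p + ((-p).toNat : ℤ) = 0 := by omega
    rw [this, LaurentPolynomial.T_zero, one_mul]
  · have h0 : (-p).toNat = 0 := by omega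
    rw [h0, pow_zero, Polynomial.divByMonic_one, map_mul, Polynomial.toLaurent_X_pow,
      Int.toNat_of_nonneg hp]

/-- An `ω`-pair: mutually inverse homomorphisms `σ(ω) : N_ω → N_{-ω}` and
`σ(-ω) : N_{-ω} → N_ω` with `σ(±ω)(x_α(f)) = x_α(X ^ (±⟨ω, α⟩) * f)` for all `x_α(f)` in the
generating set of `N_{±ω}`. -/
structure WeightPair {ℓ : ℕ} (A : Type*) [CommRing A] (ω : weightLattice ℓ) where
  /-- the homomorphism `σ(ω)` -/
  pos : N A ω →* N A (-ω)
  /-- the homomorphism `σ(-ω)` -/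
  neg : N A (-ω) →* N A ω
  neg_pos : ∀ g, neg (pos g) = g
  pos_neg : ∀ g, pos (neg g) = g
  pos_x : ∀ (α : Root ℓ) (f : A[X]) (h : Admissible ω α f),
    (pos ⟨Steinberg.x α f, x_mem_N h⟩ : Steinberg ℓ A[X]) =
      Steinberg.x α (shift (pairing ω α) f)
  neg_x : ∀ (α : Root ℓ) (f : A[X]) (h : Admissible (-ω) α f),
    (neg ⟨Steinberg.x α f, x_mem_N h⟩ : Steinberg ℓ A[X]) =
      Steinberg.x α (shift (-pairing ω α) f)

end TypeA

end

/-! On matrices, the required map is conjugation by D = diag(X, 1, …, 1); the work is to lift it to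
the Steinberg group. Split x_{ij}(f) as x_{ij}(X · divX f) · x_{ij}(f(0)) and treat the congruence
part (trivial at X = 0) and the constant part separately.

Constant part: over N_{ϖ₁} the matrix at X = 0 has first column e_0. Conjugation by D then only
multiplies the unipotent radical by X, which is easily lifted: this is `twist (X - 1)`.

Congruence part: conjugates of x_{ij}(Xc) by all constant matrices g are needed. For u = g e_i and v
= e_j g⁻¹ the matrix D(1 + Xc uv)D⁻¹ = 1 + c (Du)(XvD⁻¹) is polynomial, and `unip u v c` lifts it.
If u is not a multiple of e_0 modulo the maximal ideal, elementary matrices fixing e_0 carry some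
e_i with i ≠ 0 to u, and for u = e_i there is the explicit lift `wrow`; `twist_semiconjBy_wrow`
shows that the transported lift depends only on u, v and c. Any other u is written as (u + w) - w
with w and u + w of the first kind. For this to be consistent, the orthogonal complement of v must
contain two columns independent modulo e_0 and the maximal ideal; together with the common frames
used in the commutator formula, this is where n ≥ 4 enters.

The lifts satisfy the Steinberg commutator formula (`unip_mul_unip`), so assigning to x_{ij}(f) the
function g ↦ `frameUnip g i j (divX f)` and the matrix 1 + f(0)e_{ij} respects the relations in a
semidirect product; this is `frameHom`. Evaluating the function at g = 1 and multiplying by the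
twisted constant part gives σ(ϖ₁) (`weightHom`). The inverse σ(-ϖ₁) is obtained from it by the
contragredient automorphism. -/

noncomputable section

namespace TypeA

/-! ### Elementary relations in the Steinberg group -/

section Elementary

variable {ℓ : ℕ} {R : Type*} [CommRing R]

/-- The generator `x_{ij}(a)` of the Steinberg group, with value `1` for `i = j`. -/
def elem (i j : Fin (ℓ + 1)) (a : R) : Steinberg ℓ R :=
  if h : i ≠ j then Steinberg.x ⟨i, j, h⟩ a else 1

theorem elem_of_ne {i j : Fin (ℓ + 1)} (h : i ≠ j) (a : R) :
    elem i j a = Steinberg.x ⟨i, j, h⟩ a := dif_pos h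

theorem x_eq_elem (α : Root ℓ) (a : R) : Steinberg.x α a = elem α.i α.j a :=
  (elem_of_ne α.ne a).symm

@[simp]
theorem elem_self (i : Fin (ℓ + 1)) (a : R) : elem i i a = 1 := dif_neg (by simp)

theorem rel_eq_one {r : FreeGroup (Root ℓ × R)} (h : SteinbergRel ℓ R r) :
    PresentedGroup.mk {r | SteinbergRel ℓ R r} r = 1 :=
  PresentedGroup.one_of_mem h

theorem elem_mul (i j : Fin (ℓ + 1)) (a b : R) : elem i j a * elem i j b = elem i j (a + b) := by
  by_cases h : i = j
  · subst h; simp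
  · have := rel_eq_one (SteinbergRel.add (⟨i, j, h⟩ : Root ℓ) a b)
    rw [map_mul, map_mul, map_inv] at this
    simp only [elem_of_ne h]
    exact mul_inv_eq_one.mp this

@[simp]
theorem elem_zero (i j : Fin (ℓ + 1)) : elem i j (0 : R) = 1 := by
  have := elem_mul i j (0 : R) 0
  rw [add_zero] at this
  exact mul_eq_left.mp this

theorem elem_neg (i j : Fin (ℓ + 1)) (a : R) : elem i j (-a) = (elem i j a)⁻¹ := by
  rw [eq_inv_iff_mul_eq_one, elem_mul, neg_add_cancel, elem_zero]

theorem elem_mul_elem {i j k : Fin (ℓ + 1)} (hij : i ≠ j) (hjk : j ≠ k) (hik : i ≠ k) (a b : R) :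
    elem i j a * elem j k b = elem i k (a * b) * elem j k b * elem i j a := by
  have := rel_eq_one (SteinbergRel.comm_add i j k hij hjk hik a b)
  rw [map_mul, map_inv, map_commutatorElement, mul_inv_eq_one, commutatorElement_def] at this
  simp only [elem_of_ne hij, elem_of_ne hjk, elem_of_ne hik]
  have h2 : Steinberg.x ⟨i, j, hij⟩ a * Steinberg.x ⟨j, k, hjk⟩ b * (Steinberg.x ⟨i, j, hij⟩ a)⁻¹ *
    (Steinberg.x ⟨j, k, hjk⟩ b)⁻¹ = Steinberg.x ⟨i, k, hik⟩ (a * b) := this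
  rw [← h2]; group

theorem elem_commute {i j k l : Fin (ℓ + 1)} (hjk : j ≠ k) (hil : i ≠ l) (a b : R) :
    Commute (elem i j a) (elem k l b) := by
  by_cases hij : i = j
  · subst hij; simp
  by_cases hkl : k = l
  · subst hkl; simp
  have := rel_eq_one (SteinbergRel.comm_one (⟨i, j, hij⟩ : Root ℓ) ⟨k, l, hkl⟩ hjk hil a b)
  rw [map_commutatorElement, commutatorElement_eq_one_iff_commute] at this
  simp only [elem_of_ne hij, elem_of_ne hkl]
  exact this

/-- A homomorphism out of the Steinberg group, given by the images of the `x_{ij}(a)`. -/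
def liftElem {H : Type*} [Group H] (f : Fin (ℓ + 1) → Fin (ℓ + 1) → R → H)
    (hadd : ∀ i j a b, i ≠ j → f i j a * f i j b = f i j (a + b))
    (hmul : ∀ i j k a b, i ≠ j → j ≠ k → i ≠ k →
      f i j a * f j k b = f i k (a * b) * f j k b * f i j a)
    (hcomm : ∀ i j k l a b, i ≠ j → k ≠ l → j ≠ k → i ≠ l →
      f i j a * f k l b = f k l b * f i j a) : Steinberg ℓ R →* H :=
  PresentedGroup.toGroup (f := fun p : Root ℓ × R => f p.1.i p.1.j p.2) (by
    rintro r (⟨α, a, b⟩ | ⟨i, j, k, hij, hjk, hik, a, b⟩ | ⟨α, β, h₁, h₂, a, b⟩)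
    · simp [hadd _ _ _ _ α.ne]
    · simp only [map_mul, map_inv, map_commutatorElement, FreeGroup.lift_apply_of]
      rw [commutatorElement_def, hmul i j k a b hij hjk hik]; group
    · simp only [map_commutatorElement, FreeGroup.lift_apply_of]
      rw [commutatorElement_eq_one_iff_mul_comm, hcomm _ _ _ _ _ _ α.ne β.ne h₁ h₂])

theorem liftElem_elem {H : Type*} [Group H] {f : Fin (ℓ + 1) → Fin (ℓ + 1) → R → H}
    (hadd hmul hcomm) {i j : Fin (ℓ + 1)} (h : i ≠ j) (a : R) :
    liftElem f hadd hmul hcomm (elem i j a) = f i j a := by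
  rw [elem_of_ne h]
  exact PresentedGroup.toGroup.of _

theorem closure_elem : Subgroup.closure
    {g | ∃ (i j : Fin (ℓ + 1)) (a : R), i ≠ j ∧ g = elem i j a} = ⊤ := by
  rw [← PresentedGroup.closure_range_of {r | SteinbergRel ℓ R r}]
  congr 1
  ext g
  constructor
  · rintro ⟨i, j, a, h, rfl⟩
    exact ⟨(⟨i, j, h⟩, a), (elem_of_ne h a).symm⟩
  · rintro ⟨⟨α, a⟩, rfl⟩
    exact ⟨α.i, α.j, a, α.ne, x_eq_elem α a⟩

/-! ### Row and column subgroups -/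

/-- The homomorphism `a ↦ x_{ij}(a)`. -/
def elemHom (i j : Fin (ℓ + 1)) : Multiplicative R →* Steinberg ℓ R where
  toFun a := elem i j a.toAdd
  map_one' := by simp
  map_mul' a b := by simp [elem_mul]

theorem elemHom_row_commute (i : Fin (ℓ + 1)) :
    Pairwise fun j k => ∀ a b : Multiplicative R, Commute (elemHom i j a) (elemHom i k b) := by
  intro j k _ a b
  change Commute (elem i j _) (elem i k _)
  by_cases hj : i = j
  · subst hj; simp
  by_cases hk : i = k
  · subst hk; simp
  exact elem_commute (Ne.symm hj) hk _ _

theorem elemHom_col_commute (i : Fin (ℓ + 1)) :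
    Pairwise fun j k => ∀ a b : Multiplicative R, Commute (elemHom j i a) (elemHom k i b) := by
  intro j k _ a b
  change Commute (elem j i _) (elem k i _)
  by_cases hj : i = j
  · subst hj; simp
  by_cases hk : i = k
  · subst hk; simp
  exact elem_commute hk (Ne.symm hj) _ _

/-- The product of the `x_{ij}(y_j)` over all `j ≠ i`, as a homomorphism in `y`. -/
def rowHom (i : Fin (ℓ + 1)) : (Fin (ℓ + 1) → Multiplicative R) →* Steinberg ℓ R :=
  MonoidHom.noncommPiCoprod (fun j => elemHom i j) (elemHom_row_commute i)

/-- The product of the `x_{ij}(w_i)` over all `i ≠ j`, as a homomorphism in `w`. -/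
def colHom (j : Fin (ℓ + 1)) : (Fin (ℓ + 1) → Multiplicative R) →* Steinberg ℓ R :=
  MonoidHom.noncommPiCoprod (fun i => elemHom i j) (elemHom_col_commute j)

/-- The product of the `x_{ij}(y_j)` over all `j ≠ i`. -/
def row (i : Fin (ℓ + 1)) (y : Fin (ℓ + 1) → R) : Steinberg ℓ R :=
  rowHom i fun j => Multiplicative.ofAdd (y j)

/-- The product of the `x_{ij}(w_i)` over all `i ≠ j`. -/
def col (j : Fin (ℓ + 1)) (w : Fin (ℓ + 1) → R) : Steinberg ℓ R :=
  colHom j fun i => Multiplicative.ofAdd (w i)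

theorem row_add (i : Fin (ℓ + 1)) (y z : Fin (ℓ + 1) → R) : row i (y + z) = row i y * row i z := by
  rw [row, row, row, ← map_mul]
  rfl

theorem col_add (i : Fin (ℓ + 1)) (y z : Fin (ℓ + 1) → R) : col i (y + z) = col i y * col i z := by
  rw [col, col, col, ← map_mul]
  rfl

@[simp]
theorem row_zero (i : Fin (ℓ + 1)) : row i (0 : Fin (ℓ + 1) → R) = 1 := by
  have := row_add i (0 : Fin (ℓ + 1) → R) 0
  rw [add_zero] at this
  exact mul_eq_left.mp this.symm

@[simp]
theorem col_zero (i : Fin (ℓ + 1)) : col i (0 : Fin (ℓ + 1) → R) = 1 := by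
  have := col_add i (0 : Fin (ℓ + 1) → R) 0
  rw [add_zero] at this
  exact mul_eq_left.mp this.symm

theorem row_neg (i : Fin (ℓ + 1)) (y : Fin (ℓ + 1) → R) : row i (-y) = (row i y)⁻¹ := by
  rw [eq_inv_iff_mul_eq_one, ← row_add, neg_add_cancel, row_zero]

theorem row_commute (i : Fin (ℓ + 1)) (y z : Fin (ℓ + 1) → R) :
    Commute (row i y) (row i z) := by
  rw [Commute, SemiconjBy, ← row_add, ← row_add, add_comm]

theorem ofAdd_single (j : Fin (ℓ + 1)) (a : R) :
    (fun k => Multiplicative.ofAdd ((Pi.single j a : Fin (ℓ + 1) → R) k)) =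
      Pi.mulSingle j (Multiplicative.ofAdd a) := by
  ext k
  by_cases h : k = j
  · subst h; simp
  · simp [h]

theorem row_single (i j : Fin (ℓ + 1)) (a : R) : row i (Pi.single j a) = elem i j a := by
  rw [row, ofAdd_single, rowHom]
  exact MonoidHom.noncommPiCoprod_mulSingle _ _ _

theorem col_single (i j : Fin (ℓ + 1)) (a : R) : col j (Pi.single i a) = elem i j a := by
  rw [col, ofAdd_single, colHom]
  exact MonoidHom.noncommPiCoprod_mulSingle _ _ _

theorem pi_induction {P : (Fin (ℓ + 1) → R) → Prop} (y : Fin (ℓ + 1) → R) (h0 : P 0)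
    (hadd : ∀ y z, P y → P z → P (y + z)) (hs : ∀ j, P (Pi.single j (y j))) : P y := by
  rw [← Finset.univ_sum_single y]
  exact Finset.sum_induction _ P (fun a b => hadd a b) h0 fun j _ => hs j

theorem pi_single_induction {P : (Fin (ℓ + 1) → R) → Prop} (zero : P 0)
    (add : ∀ y z, P y → P z → P (y + z)) (single : ∀ j a, P (Pi.single j a))
    (y : Fin (ℓ + 1) → R) : P y :=
  pi_induction y zero add fun j => single j (y j)

/-- Because `elem i i` is trivial, the entry of number `i` carries no information. -/
theorem row_congr {i : Fin (ℓ + 1)} {y z : Fin (ℓ + 1) → R} (h : ∀ j, j ≠ i → y j = z j) :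
    row i y = row i z := by
  have : y = z + Pi.single i (y i - z i) := by
    ext j
    by_cases hj : j = i
    · subst hj; simp
    · simp [hj, h j hj]
  rw [this, row_add, row_single, elem_self, mul_one]

theorem col_congr {i : Fin (ℓ + 1)} {y z : Fin (ℓ + 1) → R} (h : ∀ j, j ≠ i → y j = z j) :
    col i y = col i z := by
  have : y = z + Pi.single i (y i - z i) := by
    ext j
    by_cases hj : j = i
    · subst hj; simp
    · simp [hj, h j hj]
  rw [this, col_add, col_single, elem_self, mul_one]

/-- Commutation of an element with the rows supported on a given set. -/
theorem commute_row {i : Fin (ℓ + 1)} {g : Steinberg ℓ R} (y : Fin (ℓ + 1) → R)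
    (h : ∀ j, y j ≠ 0 → Commute g (elem i j (y j))) : Commute g (row i y) := by
  refine pi_induction (P := fun y => Commute g (row i y)) y (by simp)
    (fun y z hy hz => by rw [row_add]; exact hy.mul_right hz) fun j => ?_
  rw [row_single]
  by_cases hj : y j = 0
  · simp [hj]
  · exact h j hj

theorem row_commute_row {i k : Fin (ℓ + 1)} {y z : Fin (ℓ + 1) → R} (hy : y k = 0) (hz : z i = 0) :
    Commute (row i y) (row k z) := by
  refine commute_row z fun j hj => (commute_row y fun m hm => ?_).symm
  refine elem_commute ?_ ?_ _ _
  · rintro rfl; exact hj hz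
  · rintro rfl; exact hm hy

/-- `x_{ij}(a)` and a row with number `j`. -/
theorem elem_mul_row {i j : Fin (ℓ + 1)} (hij : i ≠ j) (a : R) (y : Fin (ℓ + 1) → R)
    (hy : y i = 0) :
    elem i j a * row j y = row i (a • (y - Pi.single j (y j))) * row j y * elem i j a := by
  set z := y - Pi.single j (y j) with hz
  have hzj : z j = 0 := by simp [hz]
  have hzi : z i = 0 := by simp [hz, hij, hy]
  rw [show row j y = row j z from row_congr fun k hk => by simp [hz, hk]]
  clear_value z
  clear hz
  -- The vanishing conditions travel with the induction: the additive step has to interchange a row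
  -- `j` with a row `i`.
  refine (pi_induction (P := fun z' => (z' i = 0 ∧ z' j = 0) ∧ (elem i j a * row j z' =
    row i (a • z') * row j z' * elem i j a)) z (by simp) ?_ ?_).2
  · rintro y z ⟨⟨hy, hy'⟩, h1⟩ ⟨⟨hz, hz'⟩, h2⟩
    refine ⟨by simp [hy, hy', hz, hz'], ?_⟩
    have hc : row j y * row i (a • z) = row i (a • z) * row j y :=
      row_commute_row hy (by simp [hz'])
    rw [row_add, ← mul_assoc, h1, mul_assoc, h2, smul_add, row_add]
    simp only [mul_assoc]
    rw [← mul_assoc (row j y), hc]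
    simp only [mul_assoc]
  · intro k
    by_cases hki : k = i
    · subst hki; simp [hzi]
    by_cases hkj : k = j
    · subst hkj; simp [hzj]
    refine ⟨⟨by simp [Ne.symm hki], by simp [Ne.symm hkj]⟩, ?_⟩
    rw [← Pi.single_smul, row_single, row_single, smul_eq_mul]
    exact elem_mul_elem hij (Ne.symm hkj) (Ne.symm hki) _ _

/-- `x_{ij}(a)` and a row with number `k ≠ j`. -/
theorem elem_mul_row_of_ne {i j k : Fin (ℓ + 1)} (hij : i ≠ j) (hjk : j ≠ k) (a : R)
    (y : Fin (ℓ + 1) → R) (hy : k ≠ i) :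
    elem i j a * row k y = row k (y - Pi.single j (a * y i)) * elem i j a := by
  induction y using pi_single_induction
  · simp
  · rename_i y z h1 h2
    have h3 : y + z - Pi.single j (a * (y + z) i) =
        (y - Pi.single j (a * y i)) + (z - Pi.single j (a * z i)) := by
      rw [Pi.add_apply, mul_add, Pi.single_add, add_sub_add_comm]
    rw [h3, row_add k y z, row_add k (y - _), ← mul_assoc, h1, mul_assoc, h2, mul_assoc]
  · rename_i m b
    by_cases hm : m = i
    · subst hm
      simp only [Pi.single_eq_same]
      rw [sub_eq_add_neg, row_add, row_neg, row_single, row_single]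
      have h := elem_mul_elem hy hij (Ne.symm hjk) b a
      rw [mul_assoc, mul_comm b] at h
      have hc : Commute (elem k m b) (elem k j (a * b)) := elem_commute (Ne.symm hy) (Ne.symm hjk) _ _
      rw [hc.inv_right.eq, mul_assoc, h]; group
    · simp only [ne_eq, Ne.symm hm, not_false_eq_true, Pi.single_eq_of_ne, mul_zero,
        Pi.single_zero, sub_zero, row_single]
      exact elem_commute hjk (Ne.symm hm) _ _

/-- `x_{ij}(a)` and a column. -/
theorem elem_mul_col {i j k : Fin (ℓ + 1)} (hij : i ≠ j) (hik : i ≠ k) (hjk : j ≠ k) (a : R)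
    (w : Fin (ℓ + 1) → R) :
    elem i j a * col k w = col k (w + Pi.single i (a * w j)) * elem i j a := by
  induction w using pi_single_induction
  · simp
  · rename_i y z h1 h2
    have h3 : y + z + Pi.single i (a * (y + z) j) =
        (y + Pi.single i (a * y j)) + (z + Pi.single i (a * z j)) := by
      rw [Pi.add_apply, mul_add, Pi.single_add, add_add_add_comm]
    rw [h3, col_add k y z, col_add k (y + _), ← mul_assoc, h1, mul_assoc, h2, mul_assoc]
  · rename_i m b
    by_cases hm : m = j
    · subst hm
      simp only [Pi.single_eq_same]
      rw [col_add, col_single, col_single, (elem_commute (Ne.symm hik) hjk b (a * b)).eq]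
      exact elem_mul_elem hij hjk hik a b
    · simp only [ne_eq, Ne.symm hm, not_false_eq_true, Pi.single_eq_of_ne, mul_zero,
        Pi.single_zero, add_zero, col_single]
      exact elem_commute (Ne.symm hm) hik _ _

end Elementary

/-! ### Matrices acting on columns and rows -/

section Action

variable {ℓ : ℕ} {A : Type*} [CommRing A]

/-- The group of invertible matrices of size `ℓ + 1`. -/
abbrev Mat (ℓ : ℕ) (A : Type*) [CommRing A] : Type _ :=
  (Matrix (Fin (ℓ + 1)) (Fin (ℓ + 1)) A)ˣ

/-- The action of `m` on columns, `u ↦ m u`. -/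
def lact (m : Mat ℓ A) (u : Fin (ℓ + 1) → A) : Fin (ℓ + 1) → A :=
  Matrix.mulVec (m : Matrix (Fin (ℓ + 1)) (Fin (ℓ + 1)) A) u

/-- The left action of `m` on rows, `v ↦ v m⁻¹`. -/
def ract (m : Mat ℓ A) (v : Fin (ℓ + 1) → A) : Fin (ℓ + 1) → A :=
  Matrix.vecMul v ((m⁻¹ : Mat ℓ A) : Matrix (Fin (ℓ + 1)) (Fin (ℓ + 1)) A)

@[simp] theorem lact_one (u : Fin (ℓ + 1) → A) : lact 1 u = u := by simp [lact]

@[simp] theorem ract_one (u : Fin (ℓ + 1) → A) : ract 1 u = u := by simp [ract]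

theorem lact_mul (m n : Mat ℓ A) (u : Fin (ℓ + 1) → A) : lact (m * n) u = lact m (lact n u) := by
  simp [lact, Matrix.mulVec_mulVec]

theorem ract_mul (m n : Mat ℓ A) (u : Fin (ℓ + 1) → A) : ract (m * n) u = ract m (ract n u) := by
  simp [ract, Matrix.vecMul_vecMul]

@[simp] theorem lact_inv_lact (m : Mat ℓ A) (u : Fin (ℓ + 1) → A) : lact m⁻¹ (lact m u) = u := by
  rw [← lact_mul]; simp

@[simp] theorem lact_lact_inv (m : Mat ℓ A) (u : Fin (ℓ + 1) → A) : lact m (lact m⁻¹ u) = u := by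
  rw [← lact_mul]; simp

@[simp] theorem ract_inv_ract (m : Mat ℓ A) (u : Fin (ℓ + 1) → A) : ract m⁻¹ (ract m u) = u := by
  rw [← ract_mul]; simp

@[simp] theorem ract_ract_inv (m : Mat ℓ A) (u : Fin (ℓ + 1) → A) : ract m (ract m⁻¹ u) = u := by
  rw [← ract_mul]; simp

theorem lact_add (m : Mat ℓ A) (u w : Fin (ℓ + 1) → A) : lact m (u + w) = lact m u + lact m w :=
  Matrix.mulVec_add _ _ _

theorem lact_smul (m : Mat ℓ A) (a : A) (u : Fin (ℓ + 1) → A) :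
    lact m (a • u) = a • lact m u := Matrix.mulVec_smul _ _ _

theorem ract_add (m : Mat ℓ A) (u w : Fin (ℓ + 1) → A) : ract m (u + w) = ract m u + ract m w :=
  Matrix.add_vecMul _ _ _

theorem ract_sub (m : Mat ℓ A) (u w : Fin (ℓ + 1) → A) : ract m (u - w) = ract m u - ract m w :=
  Matrix.sub_vecMul _ _ _

theorem ract_smul (m : Mat ℓ A) (a : A) (u : Fin (ℓ + 1) → A) :
    ract m (a • u) = a • ract m u := Matrix.smul_vecMul _ _ _

theorem ract_dotProduct_lact (m : Mat ℓ A) (v u : Fin (ℓ + 1) → A) :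
    ract m v ⬝ᵥ lact m u = v ⬝ᵥ u := by
  simp [ract, lact, Matrix.dotProduct_mulVec, Matrix.vecMul_vecMul]

theorem dotProduct_lact (m : Mat ℓ A) (v u : Fin (ℓ + 1) → A) :
    v ⬝ᵥ lact m u = ract m⁻¹ v ⬝ᵥ u := by
  rw [← ract_dotProduct_lact m _ u, ract_ract_inv]

/-- The standard basis vectors. -/
abbrev bas (i : Fin (ℓ + 1)) : Fin (ℓ + 1) → A := Pi.single i 1

/-- The elementary matrix `1 + a e_{ij}`. -/
def el {i j : Fin (ℓ + 1)} (h : i ≠ j) (a : A) : Mat ℓ A where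
  val := Matrix.transvection i j a
  inv := Matrix.transvection i j (-a)
  val_inv := by rw [Matrix.transvection_mul_transvection_same i j h]; simp
  inv_val := by rw [Matrix.transvection_mul_transvection_same i j h]; simp

theorem lact_el {i j : Fin (ℓ + 1)} (h : i ≠ j) (a : A) (u : Fin (ℓ + 1) → A) :
    lact (el h a) u = u + (a * u j) • bas i := by
  ext k
  simp [lact, el, Matrix.transvection, Matrix.add_mulVec, Matrix.single_mulVec,
    Function.update_apply, Pi.single_apply]

theorem ract_el {i j : Fin (ℓ + 1)} (h : i ≠ j) (a : A) (v : Fin (ℓ + 1) → A) :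
    ract (el h a) v = v - (a * v i) • bas j := by
  have : ((el h a)⁻¹ : Mat ℓ A).val = Matrix.transvection i j (-a) := rfl
  rw [ract, this, Matrix.transvection, Matrix.vecMul_add, Matrix.vecMul_one, sub_eq_add_neg]
  congr 1
  ext k
  by_cases hk : k = j
  · subst hk
    simp [Matrix.vecMul, dotProduct, Matrix.single_apply, mul_comm]
  · simp [Matrix.vecMul, dotProduct, hk, Ne.symm hk]

theorem mat_ext {m n : Mat ℓ A} (h : ∀ u, lact m u = lact n u) : m = n :=
  Units.ext (Matrix.ext_of_mulVec_single fun _ => h _)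

end Action

/-! ### Lifting conjugation by D on matrices with first column e_0 -/

section Twist

open Polynomial

variable {ℓ : ℕ} {A : Type*} [CommRing A]

/-- The vector with entries `c * v_j` over the polynomial ring. -/
def emb (c : A[X]) (v : Fin (ℓ + 1) → A) : Fin (ℓ + 1) → A[X] := fun j => c * C (v j)

theorem emb_add (c : A[X]) (v w : Fin (ℓ + 1) → A) : emb c (v + w) = emb c v + emb c w := by
  ext1 j; simp [emb, mul_add]

theorem emb_sub (c : A[X]) (v w : Fin (ℓ + 1) → A) : emb c (v - w) = emb c v - emb c w := by
  ext1 j; simp [emb, mul_sub]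

theorem add_emb (c d : A[X]) (v : Fin (ℓ + 1) → A) : emb (c + d) v = emb c v + emb d v := by
  ext1 j; simp [emb, add_mul]

theorem emb_smul (c : A[X]) (a : A) (v : Fin (ℓ + 1) → A) : emb c (a • v) = emb (c * C a) v := by
  ext1 j; simp [emb, mul_assoc]

theorem smul_emb (c d : A[X]) (v : Fin (ℓ + 1) → A) : d • emb c v = emb (d * c) v := by
  ext1 j; simp [emb, mul_assoc]

@[simp] theorem emb_zero (c : A[X]) : emb c (0 : Fin (ℓ + 1) → A) = 0 := by
  ext1 j; simp [emb]

@[simp] theorem zero_emb (v : Fin (ℓ + 1) → A) : emb 0 v = 0 := by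
  ext1 j; simp [emb]

theorem emb_bas (c : A[X]) (i : Fin (ℓ + 1)) : emb c (bas i : Fin (ℓ + 1) → A) = Pi.single i c := by
  ext1 j
  by_cases h : j = i
  · subst h; simp [emb]
  · simp [emb, h]

/-- The group generated by the pairs of `x_{ij}(a)` and the elementary matrix `1 + a e_{ij}`, for
`a` in `A` and `j ≠ 0`. -/
def levGroup (ℓ : ℕ) (A : Type*) [CommRing A] : Subgroup (Steinberg ℓ A[X] × Mat ℓ A) :=
  Subgroup.closure {p | ∃ (i j : Fin (ℓ + 1)) (h : i ≠ j) (a : A), j ≠ 0 ∧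
    p = (elem i j (C a), el h a)}

theorem mem_levGroup {i j : Fin (ℓ + 1)} (h : i ≠ j) (a : A) (hj : j ≠ 0) :
    (elem i j (C a), el h a) ∈ levGroup ℓ A :=
  Subgroup.subset_closure ⟨i, j, h, a, hj, rfl⟩

theorem levGroup_lact_bas {p : Steinberg ℓ A[X] × Mat ℓ A} (hp : p ∈ levGroup ℓ A) :
    lact p.2 (bas 0) = bas 0 := by
  induction hp using Subgroup.closure_induction with
  | mem p hp =>
    obtain ⟨i, j, h, a, hj, rfl⟩ := hp
    simp [lact_el, hj]
  | one => simp
  | mul p q _ _ hp hq => rw [Prod.snd_mul, lact_mul, hq, hp]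
  | inv p _ hp => rw [Prod.snd_inv, ← hp, lact_inv_lact, hp]

theorem ract_apply_zero {p : Steinberg ℓ A[X] × Mat ℓ A} (hp : p ∈ levGroup ℓ A)
    (v : Fin (ℓ + 1) → A) : ract p.2 v 0 = v 0 := by
  have h := ract_dotProduct_lact p.2 v (bas 0)
  rw [levGroup_lact_bas hp] at h
  simpa using h

theorem levGroup_semiconjBy_row {p : Steinberg ℓ A[X] × Mat ℓ A} (hp : p ∈ levGroup ℓ A) (c : A[X])
    {v : Fin (ℓ + 1) → A} (hv : v 0 = 0) :
    SemiconjBy p.1 (row 0 (emb c v)) (row 0 (emb c (ract p.2 v))) := by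
  induction hp using Subgroup.closure_induction generalizing v with
  | mem p hp =>
    obtain ⟨i, j, h, a, hj, rfl⟩ := hp
    simp only [ract_el]
    by_cases hi : i = 0
    · subst hi
      rw [hv, mul_zero, zero_smul, sub_zero, ← row_single]
      exact row_commute _ _ _
    · have := elem_mul_row_of_ne h hj (C a) (emb c v) (Ne.symm hi)
      rw [SemiconjBy, this, emb_sub, emb_smul, emb_bas]
      congr 4
      simp only [emb, C_mul]
      ring
  | one => simp
  | mul p q hp hq h1 h2 =>
    rw [Prod.snd_mul, ract_mul]
    exact (h1 (by rw [ract_apply_zero hq, hv])).mul_left (h2 hv)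
  | inv p hp h =>
    have := h (v := ract p⁻¹.2 v) (by rw [ract_apply_zero (inv_mem hp), hv])
    rw [Prod.snd_inv, ract_ract_inv] at this
    exact this.inv_symm_left

/-- For a matrix `m` with first column `e_0`, the row `r` such that `m` is the product of
`1 + e_0 r` and of a block diagonal matrix. -/
def radical (m : Mat ℓ A) : Fin (ℓ + 1) → A := bas 0 - ract m (bas 0)

/-- The difference e_0 - e_0 m⁻¹ is a cocycle; this is what makes `twist c` multiplicative. -/
theorem radical_mul (m n : Mat ℓ A) : radical (m * n) = radical m + ract m (radical n) := by
  rw [radical, radical, radical, ract_mul, ract_sub]; abel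

theorem radical_apply_zero {p : Steinberg ℓ A[X] × Mat ℓ A} (hp : p ∈ levGroup ℓ A) :
    radical p.2 0 = 0 := by
  simp [radical, ract_apply_zero hp]

/-- The element `p` with its unipotent part raised to the power `1 + c`. -/
def twist (c : A[X]) (p : Steinberg ℓ A[X] × Mat ℓ A) : Steinberg ℓ A[X] :=
  row 0 (emb c (radical p.2)) * p.1

theorem twist_mul (c : A[X]) {p q : Steinberg ℓ A[X] × Mat ℓ A} (hp : p ∈ levGroup ℓ A)
    (hq : q ∈ levGroup ℓ A) : twist c (p * q) = twist c p * twist c q := by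
  have := (levGroup_semiconjBy_row hp c (radical_apply_zero hq)).eq
  rw [twist, twist, twist, Prod.fst_mul, Prod.snd_mul, radical_mul, emb_add, row_add, mul_assoc,
    ← mul_assoc _ p.1 q.1, ← this]
  simp only [mul_assoc]

@[simp] theorem twist_one (c : A[X]) : twist c (1 : Steinberg ℓ A[X] × Mat ℓ A) = 1 := by
  simp [twist, radical]

theorem twist_inv (c : A[X]) {p : Steinberg ℓ A[X] × Mat ℓ A} (hp : p ∈ levGroup ℓ A) :
    twist c p⁻¹ = (twist c p)⁻¹ := by
  rw [eq_inv_iff_mul_eq_one, ← twist_mul c (inv_mem hp) hp, inv_mul_cancel, twist_one]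

theorem twist_elem (c : A[X]) {i j : Fin (ℓ + 1)} (h : i ≠ j) (a : A) :
    twist c (elem i j (C a), el h a) = elem i j (if i = 0 then (c + 1) * C a else C a) := by
  simp only [twist, radical, ract_el, sub_sub_cancel, emb_smul, emb_bas, row_single]
  by_cases hi : i = 0
  · subst hi
    simp [elem_mul, add_mul]
  · simp [hi]

/-- For c = -1 the twist removes the unipotent radical, and only the block diagonal part acts. The
radical would change just the entry 0 of the column, which `col 0` ignores. -/
theorem twist_neg_one_semiconjBy_col {p : Steinberg ℓ A[X] × Mat ℓ A} (hp : p ∈ levGroup ℓ A)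
    (c : A[X]) (u : Fin (ℓ + 1) → A) :
    SemiconjBy (twist (-1) p) (col 0 (emb c u)) (col 0 (emb c (lact p.2 u))) := by
  induction hp using Subgroup.closure_induction generalizing u with
  | mem p hp =>
    obtain ⟨i, j, h, a, hj, rfl⟩ := hp
    rw [twist_elem]
    simp only [lact_el]
    by_cases hi : i = 0
    · subst hi
      rw [if_pos rfl, neg_add_cancel, zero_mul, elem_zero]
      rw [SemiconjBy, one_mul, mul_one]
      exact col_congr fun k hk => by simp [emb, hk]
    · rw [if_neg hi, SemiconjBy, elem_mul_col h hi hj, emb_add, emb_smul, emb_bas]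
      congr 4
      simp only [emb, C_mul]
      ring
  | one => simp
  | mul p q hp hq h1 h2 =>
    rw [twist_mul _ hp hq, Prod.snd_mul, lact_mul]
    exact (h1 _).mul_left (h2 _)
  | inv p hp h =>
    have := h (lact p⁻¹.2 u)
    rw [Prod.snd_inv, lact_lact_inv] at this
    rw [twist_inv _ hp]
    exact this.inv_symm_left

theorem twist_semiconjBy_row (d : A[X]) {p : Steinberg ℓ A[X] × Mat ℓ A} (hp : p ∈ levGroup ℓ A)
    (c : A[X]) {v : Fin (ℓ + 1) → A} (hv : v 0 = 0) :
    SemiconjBy (twist d p) (row 0 (emb c v)) (row 0 (emb c (ract p.2 v))) :=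
  SemiconjBy.mul_left (row_commute _ _ _) (levGroup_semiconjBy_row hp c hv)

theorem twist_eq_row_mul (p : Steinberg ℓ A[X] × Mat ℓ A) :
    twist (X - 1) p = row 0 (emb X (radical p.2)) * twist (-1) p := by
  rw [twist, twist, ← mul_assoc, ← row_add, ← add_emb, sub_eq_add_neg]

/-- The vector `v` with its entry of number `0` replaced by `0`. -/
def off (v : Fin (ℓ + 1) → A) : Fin (ℓ + 1) → A := v - v 0 • bas 0

@[simp] theorem off_zero (v : Fin (ℓ + 1) → A) : off v 0 = 0 := by simp [off]

theorem off_apply (v : Fin (ℓ + 1) → A) {i : Fin (ℓ + 1)} (hi : i ≠ 0) : off v i = v i := by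
  simp [off, hi]

theorem off_add (v w : Fin (ℓ + 1) → A) : off (v + w) = off v + off w := by
  simp only [off, Pi.add_apply, add_smul]; abel

/-- The product of `x_{i0}(c v_0)` and of the `x_{ij}(X c v_j)` for `j ≠ 0, i`. -/
def wrow (i : Fin (ℓ + 1)) (v : Fin (ℓ + 1) → A) (c : A[X]) : Steinberg ℓ A[X] :=
  row i (emb (X * c) (off v)) * elem i 0 (c * C (v 0))

theorem wrow_eq_row (i : Fin (ℓ + 1)) (v : Fin (ℓ + 1) → A) (c : A[X]) :
    wrow i v c = row i (emb (X * c) (off v) + Pi.single 0 (c * C (v 0))) := by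
  rw [wrow, row_add, row_single]

/-- Reduces rows of number i ≠ 0 to row 0 and column 0, whose conjugates under `twist` are known. -/
theorem row_eq_commutator {i : Fin (ℓ + 1)} (hi : i ≠ 0) {y : Fin (ℓ + 1) → A[X]} (hy : y i = 0)
    (hy0 : y 0 = 0) : row i y = elem i 0 1 * row 0 y * (elem i 0 1)⁻¹ * (row 0 y)⁻¹ := by
  rw [elem_mul_row hi 1 y hy, hy0]
  simp

theorem elem_eq_col (i : Fin (ℓ + 1)) (c : A[X]) :
    elem i 0 c = col 0 (emb c (bas i : Fin (ℓ + 1) → A)) := by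
  rw [emb_bas, col_single]

theorem twist_neg_one_semiconjBy_wrow {p : Steinberg ℓ A[X] × Mat ℓ A} (hp : p ∈ levGroup ℓ A)
    {i k : Fin (ℓ + 1)} (hi : i ≠ 0) (hk : k ≠ 0) (h : lact p.2 (bas i) = bas k)
    {v : Fin (ℓ + 1) → A} (hv : v i = 0) (c : A[X]) :
    SemiconjBy (twist (-1) p) (wrow i v c) (wrow k (v 0 • bas 0 + ract p.2 (off v)) c) := by
  have helem (f : A[X]) : SemiconjBy (twist (-1) p) (elem i 0 f) (elem k 0 f) := by
    have := twist_neg_one_semiconjBy_col hp f (bas i)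
    rwa [h, ← elem_eq_col, ← elem_eq_col] at this
  have hrow := twist_semiconjBy_row (-1) hp (X * c) (off_zero v)
  have h0 : ract p.2 (off v) 0 = 0 := by rw [ract_apply_zero hp, off_zero]
  have hk0 : ract p.2 (off v) k = 0 := by
    have := ract_dotProduct_lact p.2 (off v) (bas i)
    rw [h] at this
    simpa [off_apply v hi, hv] using this
  have hoff : off (v 0 • bas 0 + ract p.2 (off v)) = ract p.2 (off v) := by
    rw [off, Pi.add_apply, h0]
    simp
  rw [wrow, wrow, hoff, row_eq_commutator hi (by simp [emb, off_apply v hi, hv]) (by simp [emb]),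
    row_eq_commutator hk (by simp [emb, hk0]) (by simp [emb, h0])]
  refine ((((helem 1).mul_right hrow).mul_right (helem 1).inv_right).mul_right
    hrow.inv_right).mul_right ?_
  simpa [h0] using helem (c * C (v 0))

/-- The new row is w(1 + e_0 r)⁻¹ = w - w_0 r. The correction is the commutator of row 0 with
x_{k0}(c w_0); all other factors commute. -/
theorem row_semiconjBy_wrow {k : Fin (ℓ + 1)} (hk : k ≠ 0) {r w : Fin (ℓ + 1) → A} (hr : r k = 0)
    (hr0 : r 0 = 0) (c : A[X]) :
    SemiconjBy (row 0 (emb X r)) (wrow k w c) (wrow k (w - w 0 • r) c) := by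
  have h1 : SemiconjBy (row 0 (emb X r)) (row k (emb (X * c) (off w)))
      (row k (emb (X * c) (off w))) := row_commute_row (by simp [emb, hr]) (by simp [emb])
  have h2 := elem_mul_row hk (c * C (w 0)) (emb X r) (by simp [emb, hr])
  have h3 : emb X r 0 = 0 := by simp [emb, hr0]
  rw [h3, Pi.single_zero, sub_zero, smul_emb] at h2
  have h4 : off (w - w 0 • r) = off w - w 0 • r := by
    ext j; simp [off, hr0]; ring
  have h5 : (w - w 0 • r) 0 = w 0 := by simp [hr0]
  have h6 : SemiconjBy (row 0 (emb X r)) (elem k 0 (c * C (w 0)))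
      ((row k (emb (c * C (w 0) * X) r))⁻¹ * elem k 0 (c * C (w 0))) := by
    rw [SemiconjBy, mul_assoc, h2]; group
  rw [wrow, wrow, h4, h5, emb_sub, emb_smul, sub_eq_add_neg, row_add, row_neg, mul_assoc]
  have h7 : X * c * C (w 0) = c * C (w 0) * X := by ring
  rw [h7]
  exact h1.mul_right h6

/-- On matrices this is m(1 + Xc e_i v)m⁻¹ = 1 + Xc e_k(v m⁻¹), conjugated by D. In the Steinberg
group it follows by splitting `twist (X - 1) p` into its radical and its block diagonal part. -/
theorem twist_semiconjBy_wrow {p : Steinberg ℓ A[X] × Mat ℓ A} (hp : p ∈ levGroup ℓ A)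
    {i k : Fin (ℓ + 1)} (hi : i ≠ 0) (hk : k ≠ 0) (h : lact p.2 (bas i) = bas k)
    {v : Fin (ℓ + 1) → A} (hv : v i = 0) (c : A[X]) :
    SemiconjBy (twist (X - 1) p) (wrow i v c) (wrow k (ract p.2 v) c) := by
  rw [twist_eq_row_mul]
  have hr : radical p.2 k = 0 := by
    have := ract_dotProduct_lact p.2 (bas 0) (bas i)
    rw [h] at this
    simp only [dotProduct_single, mul_one, Pi.single_eq_of_ne hi] at this
    simp [radical, this, hk]
  have h1 := row_semiconjBy_wrow hk hr (radical_apply_zero hp) c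
    (w := v 0 • bas 0 + ract p.2 (off v))
  have h2 : (v 0 • bas 0 + ract p.2 (off v) : Fin (ℓ + 1) → A) 0 = v 0 := by simp [ract_apply_zero hp]
  have h3 : v 0 • bas 0 + ract p.2 (off v) - v 0 • radical p.2 = ract p.2 v := by
    rw [off, radical, ract_sub, ract_smul, smul_sub]; abel
  rw [h2, h3] at h1
  exact h1.mul_left (twist_neg_one_semiconjBy_wrow hp hi hk h hv c)

end Twist

/-! ### Relations between the explicit lifts, and elimination -/

section Weighted

open Polynomial

variable {ℓ : ℕ} {A : Type*} [CommRing A]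

theorem wrow_add_right (i : Fin (ℓ + 1)) (v : Fin (ℓ + 1) → A) (c d : A[X]) :
    wrow i v (c + d) = wrow i v c * wrow i v d := by
  rw [wrow_eq_row, wrow_eq_row, wrow_eq_row, ← row_add, mul_add, add_emb, add_mul, Pi.single_add,
    add_add_add_comm]

theorem wrow_add_left (i : Fin (ℓ + 1)) (v w : Fin (ℓ + 1) → A) (c : A[X]) :
    wrow i (v + w) c = wrow i v c * wrow i w c := by
  rw [wrow_eq_row, wrow_eq_row, wrow_eq_row, ← row_add, off_add, emb_add, Pi.add_apply, C_add,
    mul_add, Pi.single_add, add_add_add_comm]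

theorem wrow_smul (i : Fin (ℓ + 1)) (v : Fin (ℓ + 1) → A) (a : A) (c : A[X]) :
    wrow i (a • v) c = wrow i v (c * C a) := by
  have : off (a • v) = a • off v := by simp [off, smul_sub, mul_smul]
  rw [wrow_eq_row, wrow_eq_row, this, emb_smul, Pi.smul_apply, smul_eq_mul, C_mul, mul_assoc,
    mul_assoc]

theorem emb_off_add_single_apply {v : Fin (ℓ + 1) → A} {k : Fin (ℓ + 1)} (hk : k ≠ 0) (c : A[X]) :
    (emb (X * c) (off v) + Pi.single 0 (c * C (v 0)) : Fin (ℓ + 1) → A[X]) k =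
      X * c * C (v k) := by
  simp [emb, off_apply v hk, hk]

theorem smul_emb_off_add_single (v : Fin (ℓ + 1) → A) (c d : A[X]) :
    d • (emb (X * c) (off v) + Pi.single 0 (c * C (v 0))) =
      emb (X * (d * c)) (off v) + Pi.single 0 (d * c * C (v 0)) := by
  rw [smul_add, smul_emb, ← Pi.single_smul, smul_eq_mul, mul_assoc, mul_left_comm]

theorem elem_mul_wrow {i k : Fin (ℓ + 1)} (hik : i ≠ k) (hi : i ≠ 0) (hk : k ≠ 0)
    {v : Fin (ℓ + 1) → A} (hvi : v i = 0) (hvk : v k = 0) (c d : A[X]) :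
    elem i k d * wrow k v c = wrow i v (d * c) * wrow k v c * elem i k d := by
  rw [wrow_eq_row, wrow_eq_row, elem_mul_row hik _ _ (by simp [emb_off_add_single_apply hi, hvi]),
    emb_off_add_single_apply hk, hvk, C_0, mul_zero, Pi.single_zero, sub_zero,
    smul_emb_off_add_single]

theorem wrow_commute_wrow {i k : Fin (ℓ + 1)} (hi : i ≠ 0) (hk : k ≠ 0)
    {v w : Fin (ℓ + 1) → A} (hv : v k = 0) (hw : w i = 0) (c d : A[X]) :
    Commute (wrow i v c) (wrow k w d) := by
  rw [wrow_eq_row, wrow_eq_row]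
  exact row_commute_row (by simp [emb_off_add_single_apply hk, hv])
    (by simp [emb_off_add_single_apply hi, hw])

/-- The factor x_{ik}(X c v_k) splits off from `wrow i v c`, and the rest commutes with `wrow k w
d`. -/
theorem wrow_mul_wrow {i k : Fin (ℓ + 1)} (hik : i ≠ k) (hi : i ≠ 0) (hk : k ≠ 0)
    {v w : Fin (ℓ + 1) → A} (hwi : w i = 0) (hwk : w k = 0) (c d : A[X]) :
    wrow i v c * wrow k w d = wrow i w (X * c * d * C (v k)) * wrow k w d * wrow i v c := by
  have h1 : wrow i v c = wrow i (v - v k • bas k) c * elem i k (X * c * C (v k)) := by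
    have h : v = (v - v k • bas k) + v k • bas k := by abel
    conv_lhs => rw [h]
    rw [wrow_add_left]
    congr 1
    rw [wrow_smul, wrow_eq_row, off]
    simp only [Pi.single_eq_of_ne (Ne.symm hk), zero_smul, sub_zero, C_0, mul_zero, Pi.single_zero,
      add_zero, emb_bas, row_single, mul_assoc]
  have h2 : Commute (wrow i (v - v k • bas k) c) (wrow k w d) :=
    wrow_commute_wrow hi hk (by simp) hwi c d
  have h3 : Commute (wrow i (v - v k • bas k) c) (wrow i w (X * c * d * C (v k))) := by
    rw [wrow_eq_row, wrow_eq_row]; exact row_commute _ _ _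
  have h4 : X * c * d * C (v k) = X * c * C (v k) * d := by ring
  rw [h1, mul_assoc, elem_mul_wrow hik hi hk hwi hwk, ← h4, mul_assoc, ← mul_assoc, h3.eq,
    mul_assoc, ← mul_assoc _ (wrow k w d), h2.eq]
  simp only [mul_assoc]

theorem exists_lact_eq_bas_of_eq_one {u : Fin (ℓ + 1) → A} {j : Fin (ℓ + 1)} (hj : j ≠ 0)
    (hu : u j = 1) : ∃ p ∈ levGroup ℓ A, lact p.2 u = bas j ∧
      ∀ k, k ≠ j → lact p.2 (bas k) = bas k := by
  -- Elimination with the pivot in position `j`; `S` is the set of positions already cleared.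
  suffices h : ∀ S : Finset (Fin (ℓ + 1)), ∃ p ∈ levGroup ℓ A,
      (lact p.2 u = fun i => if i ∈ S ∧ i ≠ j then 0 else u i) ∧
      ∀ k, k ≠ j → lact p.2 (bas k) = bas k by
    obtain ⟨p, hp, h1, h2⟩ := h Finset.univ
    refine ⟨p, hp, ?_, h2⟩
    rw [h1]
    ext i
    by_cases hi : i = j
    · subst hi; simp [hu]
    · simp [hi]
  intro S
  induction S using Finset.induction_on with
  | empty => exact ⟨1, one_mem _, by simp, by simp⟩
  | insert i S hi ih =>
    obtain ⟨p, hp, h1, h2⟩ := ih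
    by_cases hij : i = j
    · subst hij
      refine ⟨p, hp, ?_, h2⟩
      rw [h1]
      ext k
      by_cases hk : k = i <;> simp [hk]
    · refine ⟨(elem i j (C (-u i)), el hij (-u i)) * p, mul_mem (mem_levGroup hij _ hj) hp, ?_, ?_⟩
      · rw [Prod.snd_mul, lact_mul, h1, lact_el]
        ext k
        by_cases hk : k = i
        · subst hk; simp [hi, hij, hu]
        · simp [hk]
      · intro k hk
        rw [Prod.snd_mul, lact_mul, h2 k hk, lact_el]
        simp [Ne.symm hk]

end Weighted

/-! ### Columns modulo e_0 and the maximal ideal -/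

section Local

open Polynomial IsLocalRing

variable {ℓ : ℕ} {A : Type*} [CommRing A] [IsLocalRing A]

/-- The columns that are multiples of `e_0` modulo the maximal ideal. -/
def small (ℓ : ℕ) (A : Type*) [CommRing A] [IsLocalRing A] : Submodule A (Fin (ℓ + 1) → A) where
  carrier := {u | ∀ i, i ≠ 0 → u i ∈ maximalIdeal A}
  add_mem' hu hw i hi := add_mem (hu i hi) (hw i hi)
  zero_mem' _ _ := zero_mem _
  smul_mem' a _ hu i hi := Ideal.mul_mem_left _ a (hu i hi)

theorem lact_mem_small {p : Steinberg ℓ A[X] × Mat ℓ A} (hp : p ∈ levGroup ℓ A)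
    {u : Fin (ℓ + 1) → A} (hu : u ∈ small ℓ A) : lact p.2 u ∈ small ℓ A := by
  intro i hi
  have h : lact p.2 u i = ract p⁻¹.2 (bas i) ⬝ᵥ u := by
    rw [Prod.snd_inv, ← dotProduct_lact]; simp
  rw [h, dotProduct]
  refine sum_mem fun j _ => ?_
  by_cases hj : j = 0
  · subst hj
    rw [ract_apply_zero (inv_mem hp)]
    simp [Ne.symm hi]
  · exact Ideal.mul_mem_left _ _ (hu j hj)

theorem lact_mem_small_iff {p : Steinberg ℓ A[X] × Mat ℓ A} (hp : p ∈ levGroup ℓ A)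
    {u : Fin (ℓ + 1) → A} : lact p.2 u ∈ small ℓ A ↔ u ∈ small ℓ A := by
  refine ⟨fun h => ?_, lact_mem_small hp⟩
  have := lact_mem_small (inv_mem hp) h
  rwa [Prod.snd_inv, lact_inv_lact] at this

theorem bas_notMem_small {i : Fin (ℓ + 1)} (hi : i ≠ 0) : (bas i : Fin (ℓ + 1) → A) ∉ small ℓ A := by
  intro h
  have := h i hi
  rw [bas, Pi.single_eq_same] at this
  exact (Ideal.ne_top_iff_one _).mp (maximalIdeal.isMaximal A).ne_top this

/-- Independence of two columns modulo the maximal ideal and `e_0`. -/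
def Indep (u w : Fin (ℓ + 1) → A) : Prop :=
  ∀ a b : A, a • u + b • w ∈ small ℓ A → a ∈ maximalIdeal A ∧ b ∈ maximalIdeal A

theorem one_notMem_maximalIdeal : (1 : A) ∉ maximalIdeal A :=
  (Ideal.ne_top_iff_one _).mp (maximalIdeal.isMaximal A).ne_top

theorem Indep.symm {u w : Fin (ℓ + 1) → A} (h : Indep u w) : Indep w u :=
  fun a b hab => (h b a (by rwa [add_comm (b • u)])).symm

theorem Indep.left {u w : Fin (ℓ + 1) → A} (h : Indep u w) : u ∉ small ℓ A :=
  fun hu => one_notMem_maximalIdeal (h 1 0 (by simpa using hu)).1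

theorem Indep.right {u w : Fin (ℓ + 1) → A} (h : Indep u w) : w ∉ small ℓ A := h.symm.left

theorem Indep.left_add_smul {u w : Fin (ℓ + 1) → A} (h : Indep u w) (a : A) : Indep (u + a • w) w := by
  intro b c hbc
  have h1 : b • u + (b * a + c) • w ∈ small ℓ A := by
    convert hbc using 1; rw [smul_add, smul_smul, add_smul]; abel
  obtain ⟨h2, h3⟩ := h _ _ h1
  refine ⟨h2, ?_⟩
  have := sub_mem h3 (Ideal.mul_mem_right a _ h2)
  rwa [add_sub_cancel_left] at this

theorem Indep.small_add {u w z : Fin (ℓ + 1) → A} (h : Indep u w) (hz : z ∈ small ℓ A) :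
    Indep (z + u) w := by
  intro a b hab
  refine h a b ?_
  have : a • u + b • w = (a • (z + u) + b • w) - a • z := by rw [smul_add]; abel
  rw [this]
  exact sub_mem hab ((small ℓ A).smul_mem a hz)

/-- A column which is not small and not independent of `u` is a multiple of `u` up to a small
column. -/
theorem exists_sub_smul_mem {u w : Fin (ℓ + 1) → A} (hu : u ∉ small ℓ A) (h : ¬ Indep u w) :
    ∃ a : A, w - a • u ∈ small ℓ A := by
  simp only [Indep, not_forall] at h
  obtain ⟨a, b, hab, h⟩ := h
  by_cases hb : b ∈ maximalIdeal A
  · have ha : a ∉ maximalIdeal A := fun ha => h ⟨ha, hb⟩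
    have h1 : b • w ∈ small ℓ A := fun i _ => Ideal.mul_mem_right _ _ hb
    have h2 : a • u ∈ small ℓ A := by simpa using sub_mem hab h1
    obtain ⟨a', rfl⟩ := notMem_maximalIdeal.mp ha
    have := (small ℓ A).smul_mem (↑a'⁻¹ : A) h2
    rw [smul_smul, Units.inv_mul, one_smul] at this
    exact absurd this hu
  · obtain ⟨b', rfl⟩ := notMem_maximalIdeal.mp hb
    refine ⟨-(↑b'⁻¹ * a), ?_⟩
    have := (small ℓ A).smul_mem (↑b'⁻¹ : A) hab
    rw [smul_add, smul_smul, smul_smul, Units.inv_mul, one_smul] at this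
    rwa [neg_smul, sub_neg_eq_add, add_comm w]

/-- Up to a small column, `z` is a unit multiple of `u`. -/
theorem Indep.of_not_indep {u w z : Fin (ℓ + 1) → A} (h : Indep u w) (hu : ¬ Indep u z)
    (hz : z ∉ small ℓ A) : Indep z w := by
  obtain ⟨a, ha⟩ := exists_sub_smul_mem h.left hu
  have haa : a ∉ maximalIdeal A := by
    intro h1
    refine hz ?_
    have h2 : a • u ∈ small ℓ A := fun i _ => Ideal.mul_mem_right _ _ h1
    simpa using add_mem ha h2
  intro b c hbc
  have h1 : (b * a) • u + c • w ∈ small ℓ A := by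
    have : (b * a) • u + c • w = (b • z + c • w) - b • (z - a • u) := by
      rw [smul_sub, smul_smul]; abel
    rw [this]
    exact sub_mem hbc ((small ℓ A).smul_mem b ha)
  obtain ⟨h2, h3⟩ := h _ _ h1
  exact ⟨((maximalIdeal.isMaximal A).isPrime.mem_or_mem h2).resolve_right haa, h3⟩

theorem Indep.map_lact {p : Steinberg ℓ A[X] × Mat ℓ A} (hp : p ∈ levGroup ℓ A)
    {u w : Fin (ℓ + 1) → A} (h : Indep u w) : Indep (lact p.2 u) (lact p.2 w) := by
  intro a b hab
  rw [← lact_smul, ← lact_smul, ← lact_add, lact_mem_small_iff hp] at hab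
  exact h a b hab

theorem exists_ne_ne_ne (hℓ : 4 ≤ ℓ + 1) (a b c : Fin (ℓ + 1)) :
    ∃ d : Fin (ℓ + 1), d ≠ a ∧ d ≠ b ∧ d ≠ c := by
  have : ({a, b, c} : Finset (Fin (ℓ + 1))).card < Fintype.card (Fin (ℓ + 1)) := by
    rw [Fintype.card_fin]
    exact lt_of_le_of_lt Finset.card_le_three hℓ
  obtain ⟨d, hd⟩ := Finset.exists_mem_notMem_of_card_lt_card (t := Finset.univ) this
  exact ⟨d, by simpa using hd.2⟩

/-- Elementary matrices cannot directly rescale the unit `u i` to 1, so it is used to create a 1 in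
another position. -/
theorem exists_lact_apply_eq_one {u : Fin (ℓ + 1) → A} {i j : Fin (ℓ + 1)} (hi : i ≠ 0)
    (hij : i ≠ j) (hu : u i ∉ maximalIdeal A) : ∃ p ∈ levGroup ℓ A, lact p.2 u j = 1 ∧
      ∀ k, k ≠ i → lact p.2 (bas k) = bas k := by
  obtain ⟨a, ha⟩ := notMem_maximalIdeal.mp hu
  refine ⟨_, mem_levGroup (Ne.symm hij) ((1 - u j) * (↑a⁻¹ : A)) hi, ?_, fun k hk => ?_⟩
  · simp [lact_el, ← ha]
  · simp [lact_el, Ne.symm hk]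

theorem exists_lact_eq_bas {u : Fin (ℓ + 1) → A} {i j : Fin (ℓ + 1)} (hi : i ≠ 0) (hj : j ≠ 0)
    (hij : i ≠ j) (hu : u i ∉ maximalIdeal A) : ∃ p ∈ levGroup ℓ A, lact p.2 u = bas j ∧
      ∀ k, k ≠ i → k ≠ j → lact p.2 (bas k) = bas k := by
  obtain ⟨p, hp, h1, h2⟩ := exists_lact_apply_eq_one hi hij hu
  obtain ⟨q, hq, h3, h4⟩ := exists_lact_eq_bas_of_eq_one hj h1
  refine ⟨q * p, mul_mem hq hp, by rw [Prod.snd_mul, lact_mul, h3], fun k hk hk' => ?_⟩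
  rw [Prod.snd_mul, lact_mul, h2 k hk, h4 k hk']

theorem exists_lact_bas_eq (hℓ : 4 ≤ ℓ + 1) {u : Fin (ℓ + 1) → A} (hu : u ∉ small ℓ A) :
    ∃ p ∈ levGroup ℓ A, ∃ i, i ≠ 0 ∧ lact p.2 (bas i) = u := by
  have : ∃ i, i ≠ 0 ∧ u i ∉ maximalIdeal A := by
    by_contra h
    push Not at h
    exact hu h
  obtain ⟨i, hi, h⟩ := this
  obtain ⟨j, hj0, hji, -⟩ := exists_ne_ne_ne hℓ 0 i i
  obtain ⟨p, hp, h1, -⟩ := exists_lact_eq_bas hi hj0 (Ne.symm hji) h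
  exact ⟨p⁻¹, inv_mem hp, j, hj0, by rw [← h1, Prod.snd_inv, lact_inv_lact]⟩

/-- After `u` is moved to a basis vector e_i, independence leaves a unit of `w` in a position k ≠ 0,
i. A fourth index is the target for `w`, reached by matrices that fix e_i. -/
theorem Indep.exists_lact_bas_eq (hℓ : 4 ≤ ℓ + 1) {u w : Fin (ℓ + 1) → A} (h : Indep u w) :
    ∃ p ∈ levGroup ℓ A, ∃ i k, i ≠ 0 ∧ k ≠ 0 ∧ i ≠ k ∧ lact p.2 (bas i) = u ∧
      lact p.2 (bas k) = w := by
  obtain ⟨p, hp, i, hi, rfl⟩ := TypeA.exists_lact_bas_eq hℓ h.left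
  have h' := h.map_lact (inv_mem hp)
  rw [Prod.snd_inv, lact_inv_lact] at h'
  have : ∃ k, k ≠ 0 ∧ k ≠ i ∧ lact p.2⁻¹ w k ∉ maximalIdeal A := by
    by_contra hc
    push Not at hc
    -- The coefficient of e_i is chosen to cancel the entry `i` of the moved `w`.
    refine one_notMem_maximalIdeal (h' (-(lact p.2⁻¹ w i)) 1 fun k hk => ?_).2
    by_cases hki : k = i
    · subst hki; simp
    · simpa [hki] using hc k hk hki
  obtain ⟨k, hk, hki, hw⟩ := this
  obtain ⟨j, hj0, hji, hjk⟩ := exists_ne_ne_ne hℓ 0 i k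
  obtain ⟨q, hq, h1, h2⟩ := exists_lact_eq_bas hk hj0 (Ne.symm hjk) hw
  refine ⟨p * q⁻¹, mul_mem hp (inv_mem hq), i, j, hi, hj0, Ne.symm hji, ?_, ?_⟩
  · conv_lhs => rw [← h2 i (Ne.symm hki) (Ne.symm hji)]
    rw [Prod.snd_mul, lact_mul, Prod.snd_inv, lact_inv_lact]
  · rw [← h1, Prod.snd_mul, lact_mul, Prod.snd_inv, lact_inv_lact, lact_lact_inv]

end Local

/-! ### The lift for columns that are not small -/

section Regular

open Polynomial IsLocalRing

variable {ℓ : ℕ} {A : Type*} [CommRing A]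

open Classical in
/-- A lift to the Steinberg group of the matrix `1 + c (D u) (X v D⁻¹)` with
`D = diag(X, 1, …, 1)`, for `v u = 0` and `u` not small. -/
def unipReg (u v : Fin (ℓ + 1) → A) (c : A[X]) : Steinberg ℓ A[X] :=
  if h : ∃ (p : Steinberg ℓ A[X] × Mat ℓ A) (i : Fin (ℓ + 1)), p ∈ levGroup ℓ A ∧ i ≠ 0 ∧
      lact p.2 (bas i) = u then
    twist (X - 1) h.choose * wrow h.choose_spec.choose (ract h.choose⁻¹.2 v) c *
      (twist (X - 1) h.choose)⁻¹
  else 1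

/-- Two choices (p, i) and (q, k) differ by q⁻¹p, which carries e_i to e_k, so
`twist_semiconjBy_wrow` compares them. Every later property of `unipReg` is read off in a convenient
frame. -/
theorem unipReg_eq {p : Steinberg ℓ A[X] × Mat ℓ A} (hp : p ∈ levGroup ℓ A) {i : Fin (ℓ + 1)}
    (hi : i ≠ 0) {v : Fin (ℓ + 1) → A} (hv : v ⬝ᵥ lact p.2 (bas i) = 0) (c : A[X]) :
    unipReg (lact p.2 (bas i)) v c =
      twist (X - 1) p * wrow i (ract p⁻¹.2 v) c * (twist (X - 1) p)⁻¹ := by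
  have h : ∃ (q : Steinberg ℓ A[X] × Mat ℓ A) (k : Fin (ℓ + 1)), q ∈ levGroup ℓ A ∧ k ≠ 0 ∧
      lact q.2 (bas k) = lact p.2 (bas i) := ⟨p, i, hp, hi, rfl⟩
  rw [unipReg, dif_pos h]
  obtain ⟨hq, hk, hqk⟩ := h.choose_spec.choose_spec
  generalize h.choose_spec.choose = k at *
  generalize h.choose = q at *
  have h1 : lact (q⁻¹ * p).2 (bas i) = bas k := by
    rw [Prod.snd_mul, lact_mul, ← hqk, Prod.snd_inv, lact_inv_lact]
  have h2 : ract p⁻¹.2 v i = 0 := by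
    rw [dotProduct_lact] at hv
    simpa using hv
  have h3 := (twist_semiconjBy_wrow (mul_mem (inv_mem hq) hp) hi hk h1 h2 c).eq
  rw [twist_mul _ (inv_mem hq) hp, twist_inv _ hq, ← ract_mul, ← Prod.snd_mul,
    mul_inv_cancel_right] at h3
  rw [eq_mul_inv_iff_mul_eq, mul_assoc _ _ (twist (X - 1) p), mul_assoc, ← h3]
  group

variable [IsLocalRing A]

theorem unipReg_semiconjBy (hℓ : 4 ≤ ℓ + 1) {q : Steinberg ℓ A[X] × Mat ℓ A}
    (hq : q ∈ levGroup ℓ A) {u v : Fin (ℓ + 1) → A} (hu : u ∉ small ℓ A) (hv : v ⬝ᵥ u = 0)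
    (c : A[X]) :
    SemiconjBy (twist (X - 1) q) (unipReg u v c) (unipReg (lact q.2 u) (ract q.2 v) c) := by
  obtain ⟨p, hp, i, hi, rfl⟩ := exists_lact_bas_eq hℓ hu
  have h2 : ract q.2 v ⬝ᵥ lact (q * p).2 (bas i) = 0 := by
    rw [Prod.snd_mul, lact_mul, ract_dotProduct_lact, hv]
  rw [unipReg_eq hp hi hv, ← lact_mul, ← Prod.snd_mul, unipReg_eq (mul_mem hq hp) hi h2, mul_inv_rev,
    Prod.snd_mul, ract_mul, Prod.snd_inv q, ract_inv_ract, twist_mul _ hq hp, SemiconjBy]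
  group

theorem unipReg_add_right (hℓ : 4 ≤ ℓ + 1) {u v : Fin (ℓ + 1) → A} (hu : u ∉ small ℓ A)
    (hv : v ⬝ᵥ u = 0) (c d : A[X]) : unipReg u v (c + d) = unipReg u v c * unipReg u v d := by
  obtain ⟨p, hp, i, hi, rfl⟩ := exists_lact_bas_eq hℓ hu
  simp only [unipReg_eq hp hi hv, wrow_add_right]
  group

theorem unipReg_zero (hℓ : 4 ≤ ℓ + 1) {u v : Fin (ℓ + 1) → A} (hu : u ∉ small ℓ A)
    (hv : v ⬝ᵥ u = 0) : unipReg u v 0 = 1 := by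
  have := unipReg_add_right hℓ hu hv 0 0
  rw [add_zero] at this
  exact mul_eq_left.mp this.symm

theorem unipReg_row_add (hℓ : 4 ≤ ℓ + 1) {u v w : Fin (ℓ + 1) → A} (hu : u ∉ small ℓ A)
    (hv : v ⬝ᵥ u = 0) (hw : w ⬝ᵥ u = 0) (c : A[X]) :
    unipReg u (v + w) c = unipReg u v c * unipReg u w c := by
  obtain ⟨p, hp, i, hi, rfl⟩ := exists_lact_bas_eq hℓ hu
  rw [unipReg_eq hp hi hv, unipReg_eq hp hi hw,
    unipReg_eq hp hi (by rw [add_dotProduct, hv, hw, add_zero]), ract_add, wrow_add_left]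
  group

theorem unipReg_row_smul (hℓ : 4 ≤ ℓ + 1) {u v : Fin (ℓ + 1) → A} (hu : u ∉ small ℓ A)
    (hv : v ⬝ᵥ u = 0) (a : A) (c : A[X]) : unipReg u (a • v) c = unipReg u v (c * C a) := by
  obtain ⟨p, hp, i, hi, rfl⟩ := exists_lact_bas_eq hℓ hu
  rw [unipReg_eq hp hi hv, unipReg_eq hp hi (by rw [smul_dotProduct, hv, smul_zero]), ract_smul,
    wrow_smul]

theorem Indep.unipReg_mul (hℓ : 4 ≤ ℓ + 1) {u₁ u₂ v₁ v₂ : Fin (ℓ + 1) → A} (h : Indep u₁ u₂)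
    (h₁ : v₁ ⬝ᵥ u₁ = 0) (h₂₁ : v₂ ⬝ᵥ u₁ = 0) (h₂ : v₂ ⬝ᵥ u₂ = 0) (c d : A[X]) :
    unipReg u₁ v₁ c * unipReg u₂ v₂ d =
      unipReg u₁ v₂ (X * c * d * C (v₁ ⬝ᵥ u₂)) * unipReg u₂ v₂ d * unipReg u₁ v₁ c := by
  obtain ⟨p, hp, i, k, hi, hk, hik, rfl, rfl⟩ := h.exists_lact_bas_eq hℓ
  rw [unipReg_eq hp hi h₁, unipReg_eq hp hi h₂₁, unipReg_eq hp hk h₂]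
  rw [dotProduct_lact] at h₂₁ h₂ ⊢
  have := wrow_mul_wrow hik hi hk (v := ract p⁻¹.2 v₁) (w := ract p⁻¹.2 v₂) (by simpa using h₂₁)
    (by simpa using h₂) c d
  have e : ract p.2⁻¹ v₁ ⬝ᵥ bas k = ract p⁻¹.2 v₁ k := by simp
  rw [e]
  calc _ = twist (X - 1) p * (wrow i (ract p⁻¹.2 v₁) c * wrow k (ract p⁻¹.2 v₂) d) *
        (twist (X - 1) p)⁻¹ := by group
    _ = _ := by rw [this]; group

/-- If p carries e_i, e_k to u, w, then p(1 + a e_{ik}) carries e_k to w + a u. In this frame the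
claim is the commutator of x_{ik}(a) with `wrow k`; the row is unchanged since v kills u. -/
theorem Indep.unipReg_add_smul (hℓ : 4 ≤ ℓ + 1) {u w v : Fin (ℓ + 1) → A} (h : Indep u w)
    (hu : v ⬝ᵥ u = 0) (hw : v ⬝ᵥ w = 0) (a : A) (c : A[X]) :
    unipReg (w + a • u) v c = unipReg u v (c * C a) * unipReg w v c := by
  obtain ⟨p, hp, i, k, hi, hk, hik, rfl, rfl⟩ := h.exists_lact_bas_eq hℓ
  set e : Steinberg ℓ A[X] × Mat ℓ A := (elem i k (C a), el hik a) with he_def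
  have he : e ∈ levGroup ℓ A := mem_levGroup hik a hk
  have h1 : lact p.2 (bas k) + a • lact p.2 (bas i) = lact (p * e).2 (bas k) := by
    rw [Prod.snd_mul, lact_mul, he_def, lact_el, lact_add, lact_smul]
    simp
  have h2 : v ⬝ᵥ lact (p * e).2 (bas k) = 0 := by
    rw [← h1, dotProduct_add, dotProduct_smul, hu, hw, smul_zero, add_zero]
  rw [h1, unipReg_eq hp hi hu, unipReg_eq hp hk hw, unipReg_eq (mul_mem hp he) hk h2,
    twist_mul _ hp he, twist_elem, if_neg hi, mul_inv_rev, Prod.snd_mul, ract_mul]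
  rw [dotProduct_lact] at hu hw
  have hu' : ract p⁻¹.2 v i = 0 := by simpa using hu
  have hw' : ract p⁻¹.2 v k = 0 := by simpa using hw
  have h3 : ract e⁻¹.2 (ract p⁻¹.2 v) = ract p⁻¹.2 v := by
    have : ract e.2 (ract p⁻¹.2 v) = ract p⁻¹.2 v := by
      rw [he_def, ract_el, hu']; simp
    conv_lhs => rw [← this]
    rw [Prod.snd_inv, ract_inv_ract]
  rw [h3]
  have h4 := elem_mul_wrow hik hi hk hu' hw' c (C a)
  rw [mul_comm (C a)] at h4
  calc _ = twist (X - 1) p * (elem i k (C a) * wrow k (ract p⁻¹.2 v) c) *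
        (elem i k (C a))⁻¹ * (twist (X - 1) p)⁻¹ := by group
    _ = _ := by rw [h4]; group

end Regular

/-! ### Extension of the lift to all columns orthogonal to an ample row -/

section General

open Polynomial IsLocalRing

variable {ℓ : ℕ} {A : Type*} [CommRing A] [IsLocalRing A]

/-- The rows whose orthogonal complement is large. -/
def Ample (v : Fin (ℓ + 1) → A) : Prop :=
  ∃ u w : Fin (ℓ + 1) → A, v ⬝ᵥ u = 0 ∧ v ⬝ᵥ w = 0 ∧ Indep u w

theorem Ample.exists_indep {v u : Fin (ℓ + 1) → A} (hv : Ample v) (hu : u ∉ small ℓ A) :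
    ∃ w, v ⬝ᵥ w = 0 ∧ Indep u w := by
  obtain ⟨x, y, hx, hy, h⟩ := hv
  by_cases h1 : Indep x u
  · exact ⟨x, hx, h1.symm⟩
  · exact ⟨y, hy, h.of_not_indep h1 hu⟩

theorem Ample.smul {v : Fin (ℓ + 1) → A} (hv : Ample v) (a : A) : Ample (a • v) := by
  obtain ⟨x, y, hx, hy, h⟩ := hv
  exact ⟨x, y, by rw [smul_dotProduct, hx, smul_zero], by rw [smul_dotProduct, hy, smul_zero], h⟩

theorem Ample.ract {p : Steinberg ℓ A[X] × Mat ℓ A} (hp : p ∈ levGroup ℓ A) {v : Fin (ℓ + 1) → A}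
    (hv : Ample v) : Ample (ract p.2 v) := by
  obtain ⟨x, y, hx, hy, h⟩ := hv
  exact ⟨lact p.2 x, lact p.2 y, by rw [ract_dotProduct_lact, hx],
    by rw [ract_dotProduct_lact, hy], h.map_lact hp⟩

/-- Modulo small columns `z` is a multiple of `u`, and adding it to `w` preserves independence. This
gives the recurring device: a bad `z` is handled as (z + w) - w. -/
theorem Indep.add_of_not_indep {u w z : Fin (ℓ + 1) → A} (h : Indep u w) (hz : ¬ Indep u z) :
    Indep u (z + w) := by
  obtain ⟨a, ha⟩ := exists_sub_smul_mem h.left hz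
  have := ((h.symm.left_add_smul a).small_add ha).symm
  convert this using 1
  abel

theorem Indep.add_notMem {u w : Fin (ℓ + 1) → A} (h : Indep u w) : u + w ∉ small ℓ A := by
  have := (h.left_add_smul 1).left
  rwa [one_smul] at this

theorem not_indep_of_add_mem {u w : Fin (ℓ + 1) → A} (h : u + w ∈ small ℓ A) : ¬ Indep u w :=
  fun h' => h'.add_notMem h

theorem not_indep_add {u w : Fin (ℓ + 1) → A} (h : ¬ Indep u w) : ¬ Indep u (u + w) := by
  intro h'
  have := (h'.symm.left_add_smul (-1)).symm
  rw [neg_smul, one_smul, add_neg_cancel_comm] at this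
  exact h this

/-- For independent columns the commutator formula has coefficient v · w = 0. Otherwise an auxiliary
x independent of u reduces w to w + x and x. -/
theorem unipReg_commute (hℓ : 4 ≤ ℓ + 1) {v u w : Fin (ℓ + 1) → A} (hv : Ample v)
    (hu : u ∉ small ℓ A) (hw : w ∉ small ℓ A) (hvu : v ⬝ᵥ u = 0) (hvw : v ⬝ᵥ w = 0) (c d : A[X]) :
    Commute (unipReg u v c) (unipReg w v d) := by
  have key : ∀ {x : Fin (ℓ + 1) → A}, v ⬝ᵥ x = 0 → Indep u x →
      Commute (unipReg u v c) (unipReg x v d) := by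
    intro x hx h
    have := h.unipReg_mul hℓ hvu hvu hx c d
    rwa [hx, C_0, mul_zero, unipReg_zero hℓ hu hvu, one_mul] at this
  by_cases h : Indep u w
  · exact key hvw h
  · obtain ⟨x, hx, hux⟩ := hv.exists_indep hu
    have h1 := (hux.of_not_indep h hw).symm.unipReg_add_smul hℓ hx hvw 1 d
    rw [one_smul, C_1, mul_one] at h1
    have h2 := key (by rw [dotProduct_add, hvw, hx, add_zero]) (hux.add_of_not_indep h)
    rw [h1] at h2
    have h3 := (key hx hux).inv_right.mul_right h2
    rwa [inv_mul_cancel_left] at h3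

theorem unipReg_add (hℓ : 4 ≤ ℓ + 1) {v u w : Fin (ℓ + 1) → A} (hv : Ample v)
    (hu : u ∉ small ℓ A) (hw : w ∉ small ℓ A) (huw : u + w ∉ small ℓ A) (hvu : v ⬝ᵥ u = 0)
    (hvw : v ⬝ᵥ w = 0) (c : A[X]) : unipReg (u + w) v c = unipReg u v c * unipReg w v c := by
  have key : ∀ {x y : Fin (ℓ + 1) → A}, v ⬝ᵥ x = 0 → v ⬝ᵥ y = 0 → Indep x y →
      unipReg (x + y) v c = unipReg x v c * unipReg y v c := by
    intro x y hx hy h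
    have := h.unipReg_add_smul hℓ hx hy 1 c
    rwa [one_smul, C_1, mul_one, add_comm] at this
  by_cases h : Indep u w
  · exact key hvu hvw h
  · obtain ⟨x, hx, hux⟩ := hv.exists_indep hu
    have h1 := key (by rw [dotProduct_add, hvu, hvw, add_zero]) hx
      (hux.of_not_indep (not_indep_add h) huw)
    have h2 := key hvu (by rw [dotProduct_add, hvw, hx, add_zero]) (hux.add_of_not_indep h)
    rw [key hvw hx (hux.of_not_indep h hw), ← add_assoc, h1, ← mul_assoc] at h2
    exact mul_right_cancel h2

open Classical in
/-- A lift to the Steinberg group of the matrix `1 + c (D u) (X v D⁻¹)` with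
`D = diag(X, 1, …, 1)`, for `v u = 0`. -/
def unip (u v : Fin (ℓ + 1) → A) (c : A[X]) : Steinberg ℓ A[X] :=
  if u ∈ small ℓ A then
    if h : ∃ w, v ⬝ᵥ w = 0 ∧ w ∉ small ℓ A then
      unipReg (u + h.choose) v c * (unipReg h.choose v c)⁻¹
    else 1
  else unipReg u v c

theorem unip_of_notMem {u : Fin (ℓ + 1) → A} (hu : u ∉ small ℓ A) (v : Fin (ℓ + 1) → A) (c : A[X]) :
    unip u v c = unipReg u v c := by
  rw [unip, if_neg hu]

theorem add_notMem {u w : Fin (ℓ + 1) → A} (hu : u ∈ small ℓ A) (hw : w ∉ small ℓ A) :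
    u + w ∉ small ℓ A := fun h => hw (by simpa using sub_mem h hu)

theorem unip_mul_unipReg (hℓ : 4 ≤ ℓ + 1) {v u w : Fin (ℓ + 1) → A} (hv : Ample v)
    (hw : w ∉ small ℓ A) (huw : u + w ∉ small ℓ A) (hvu : v ⬝ᵥ u = 0)
    (hvw : v ⬝ᵥ w = 0) (c : A[X]) : unip u v c * unipReg w v c = unipReg (u + w) v c := by
  by_cases hu : u ∈ small ℓ A
  · rw [unip, if_pos hu]
    have h : ∃ w, v ⬝ᵥ w = 0 ∧ w ∉ small ℓ A := ⟨w, hvw, hw⟩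
    rw [dif_pos h]
    obtain ⟨hvx, hx⟩ := h.choose_spec
    generalize h.choose = x at *
    -- Both sides are the lift for u + y + z; this exchanges the auxiliary column chosen in `unip`.
    have key : ∀ {y z : Fin (ℓ + 1) → A}, v ⬝ᵥ y = 0 → v ⬝ᵥ z = 0 → y ∉ small ℓ A →
        z ∉ small ℓ A → y + z ∉ small ℓ A →
        unipReg (u + y) v c * unipReg z v c = unipReg (u + z) v c * unipReg y v c := by
      intro y z hvy hvz hy hz hyz
      have h3 := add_notMem hu hyz
      rw [← unipReg_add hℓ hv (add_notMem hu hy) hz (by rwa [add_assoc])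
        (by rw [dotProduct_add, hvu, hvy, add_zero]) hvz,
        ← unipReg_add hℓ hv (add_notMem hu hz) hy (by rwa [add_assoc, add_comm z])
        (by rw [dotProduct_add, hvu, hvz, add_zero]) hvy, add_right_comm]
    have hc := unipReg_commute hℓ hv hx hw hvx hvw c c
    rw [mul_assoc, hc.inv_left.eq, ← mul_assoc, mul_inv_eq_iff_eq_mul]
    -- The exchange needs x + w not small; if it fails, x and w are compared through a third column
    -- z independent of both.
    by_cases hxw : x + w ∈ small ℓ A
    · have h4 := not_indep_of_add_mem hxw
      obtain ⟨z, hvz, hxz⟩ := hv.exists_indep hx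
      have hwz := hxz.of_not_indep h4 hw
      have h5 := key hvx hvz hx hxz.right hxz.add_notMem
      have h6 := key hvw hvz hw hwz.right hwz.add_notMem
      have hcz := unipReg_commute hℓ hv hxz.right hx hvz hvx c c
      have hcw := unipReg_commute hℓ hv hxz.right hw hvz hvw c c
      apply mul_right_cancel (b := unipReg z v c)
      rw [mul_assoc, ← hcw.eq, ← mul_assoc, h5, mul_assoc, mul_assoc (unipReg (u + w) v c),
        ← hcz.eq, ← mul_assoc (unipReg (u + w) v c), h6, mul_assoc, hc.eq]
    · exact key hvx hvw hx hw hxw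
  · rw [unip_of_notMem hu, unipReg_add hℓ hv hu hw huw hvu hvw]

/-- Three classes, those of 0, -x and -y, must be avoided in a residue space of dimension at least
two, which has at least four elements even over 𝔽₂. The witness y - x also works when 2 = 0. -/
theorem Ample.exists_avoid {v x y : Fin (ℓ + 1) → A} (hv : Ample v)
    (hx : v ⬝ᵥ x = 0) (hy : v ⬝ᵥ y = 0) :
    ∃ w, v ⬝ᵥ w = 0 ∧ w ∉ small ℓ A ∧ x + w ∉ small ℓ A ∧ y + w ∉ small ℓ A := by
  by_cases h : Indep x y
  · refine ⟨y - x, by rw [dotProduct_sub, hx, hy, sub_zero], fun hm => ?_, ?_, fun hm => ?_⟩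
    · refine one_notMem_maximalIdeal (h (-1) 1 ?_).2
      rwa [neg_smul, one_smul, one_smul, neg_add_eq_sub]
    · rw [add_sub_cancel]; exact h.right
    · have := (h (-1) 2 (by convert hm using 1; rw [neg_smul, one_smul, two_smul]; abel)).1
      exact one_notMem_maximalIdeal (A := A) (by simpa using neg_mem this)
  by_cases hxs : x ∈ small ℓ A
  · by_cases hys : y ∈ small ℓ A
    · obtain ⟨w, z, hw, -, hwz⟩ := hv
      exact ⟨w, hw, hwz.left, add_notMem hxs hwz.left, add_notMem hys hwz.left⟩
    · obtain ⟨w, hw, hyw⟩ := hv.exists_indep hys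
      exact ⟨w, hw, hyw.right, add_notMem hxs hyw.right, hyw.add_notMem⟩
  · obtain ⟨w, hw, hxw⟩ := hv.exists_indep hxs
    exact ⟨w, hw, hxw.right, hxw.add_notMem, (hxw.add_of_not_indep h).right⟩

theorem unip_eq (hℓ : 4 ≤ ℓ + 1) {v u w : Fin (ℓ + 1) → A} (hv : Ample v)
    (hw : w ∉ small ℓ A) (huw : u + w ∉ small ℓ A) (hvu : v ⬝ᵥ u = 0)
    (hvw : v ⬝ᵥ w = 0) (c : A[X]) : unip u v c = unipReg (u + w) v c * (unipReg w v c)⁻¹ :=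
  eq_mul_inv_of_mul_eq (unip_mul_unipReg hℓ hv hw huw hvu hvw c)

theorem unip_commute (hℓ : 4 ≤ ℓ + 1) {v u w : Fin (ℓ + 1) → A} (hv : Ample v)
    (hvu : v ⬝ᵥ u = 0) (hvw : v ⬝ᵥ w = 0) (c d : A[X]) :
    Commute (unip u v c) (unip w v d) := by
  obtain ⟨x, hvx, hx, hux, hwx⟩ := hv.exists_avoid hvu hvw
  have hvux : v ⬝ᵥ (u + x) = 0 := by rw [dotProduct_add, hvu, hvx, add_zero]
  have hvwx : v ⬝ᵥ (w + x) = 0 := by rw [dotProduct_add, hvw, hvx, add_zero]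
  rw [unip_eq hℓ hv hx hux hvu hvx, unip_eq hℓ hv hx hwx hvw hvx]
  exact ((unipReg_commute hℓ hv hux hwx hvux hvwx c d).mul_right
    (unipReg_commute hℓ hv hux hx hvux hvx c d).inv_right).mul_left
    ((unipReg_commute hℓ hv hx hwx hvx hvwx c d).mul_right
    (unipReg_commute hℓ hv hx hx hvx hvx c d).inv_right).inv_left

theorem unip_add (hℓ : 4 ≤ ℓ + 1) {v u w : Fin (ℓ + 1) → A} (hv : Ample v)
    (hvu : v ⬝ᵥ u = 0) (hvw : v ⬝ᵥ w = 0) (c : A[X]) :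
    unip (u + w) v c = unip u v c * unip w v c := by
  have hvuw : v ⬝ᵥ (u + w) = 0 := by rw [dotProduct_add, hvu, hvw, add_zero]
  obtain ⟨x, hvx, hx, hwx, huwx⟩ := hv.exists_avoid hvw hvuw
  have hvwx : v ⬝ᵥ (w + x) = 0 := by rw [dotProduct_add, hvw, hvx, add_zero]
  apply mul_right_cancel (b := unipReg x v c)
  rw [unip_mul_unipReg hℓ hv hx huwx hvuw hvx, mul_assoc, unip_mul_unipReg hℓ hv hx hwx hvw hvx,
    unip_mul_unipReg hℓ hv hwx (by rwa [← add_assoc]) hvu hvwx, add_assoc]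

theorem unip_add_right (hℓ : 4 ≤ ℓ + 1) {v u : Fin (ℓ + 1) → A} (hv : Ample v)
    (hvu : v ⬝ᵥ u = 0) (c d : A[X]) : unip u v (c + d) = unip u v c * unip u v d := by
  obtain ⟨x, hvx, hx, hux, -⟩ := hv.exists_avoid hvu hvu
  have hvux : v ⬝ᵥ (u + x) = 0 := by rw [dotProduct_add, hvu, hvx, add_zero]
  have hc := unip_commute hℓ hv hvu hvx d c
  rw [unip_of_notMem hx] at hc
  apply mul_right_cancel (b := unipReg x v (c + d))
  rw [unip_mul_unipReg hℓ hv hx hux hvu hvx, unipReg_add_right hℓ hux hvux,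
    unipReg_add_right hℓ hx hvx, ← unip_mul_unipReg hℓ hv hx hux hvu hvx,
    ← unip_mul_unipReg hℓ hv hx hux hvu hvx, mul_assoc, mul_assoc, ← mul_assoc (unip u v d), hc.eq]
  simp only [mul_assoc]

theorem unip_zero (hℓ : 4 ≤ ℓ + 1) {v u : Fin (ℓ + 1) → A} (hv : Ample v) (hvu : v ⬝ᵥ u = 0) :
    unip u v 0 = 1 := by
  have := unip_add_right hℓ hv hvu 0 0
  rw [add_zero] at this
  exact mul_eq_left.mp this.symm

theorem unip_smul (hℓ : 4 ≤ ℓ + 1) {v u : Fin (ℓ + 1) → A} (hv : Ample v)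
    (hvu : v ⬝ᵥ u = 0) (a : A) (c : A[X]) : unip (a • u) v c = unip u v (c * C a) := by
  have key : ∀ {x : Fin (ℓ + 1) → A}, v ⬝ᵥ x = 0 → x ∉ small ℓ A →
      unip (a • x) v c = unip x v (c * C a) := by
    intro x hvx hx
    obtain ⟨w, hvw, hxw⟩ := hv.exists_indep hx
    have h := hxw.unipReg_add_smul hℓ hvx hvw a c
    rw [add_comm, ← unip_mul_unipReg hℓ hv hxw.right
      (by rw [add_comm (a • x)]; exact (hxw.symm.left_add_smul a).left)
      (by rw [dotProduct_smul, hvx, smul_zero]) hvw] at h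
    rw [unip_of_notMem hx]
    exact mul_right_cancel h
  by_cases hu : u ∈ small ℓ A
  · obtain ⟨x, hvx, hx, hux, -⟩ := hv.exists_avoid hvu hvu
    have h := key (by rw [dotProduct_add, hvu, hvx, add_zero]) hux
    rw [smul_add, unip_add hℓ hv (by rw [dotProduct_smul, hvu, smul_zero])
      (by rw [dotProduct_smul, hvx, smul_zero]), key hvx hx, unip_add hℓ hv hvu hvx] at h
    exact mul_right_cancel h
  · exact key hvu hu

theorem unip_row_smul (hℓ : 4 ≤ ℓ + 1) {v u : Fin (ℓ + 1) → A} (hv : Ample v)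
    (hvu : v ⬝ᵥ u = 0) (a : A) (c : A[X]) : unip u (a • v) c = unip u v (c * C a) := by
  obtain ⟨x, hvx, hx, hux, -⟩ := hv.exists_avoid hvu hvu
  rw [unip_eq hℓ hv hx hux hvu hvx, unip_eq hℓ (hv.smul a) hx hux
    (by rw [smul_dotProduct, hvu, smul_zero]) (by rw [smul_dotProduct, hvx, smul_zero]),
    unipReg_row_smul hℓ hx hvx,
    unipReg_row_smul hℓ hux (by rw [dotProduct_add, hvu, hvx, add_zero])]

theorem unip_semiconjBy (hℓ : 4 ≤ ℓ + 1) {q : Steinberg ℓ A[X] × Mat ℓ A}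
    (hq : q ∈ levGroup ℓ A) {u v : Fin (ℓ + 1) → A} (hv : Ample v) (hvu : v ⬝ᵥ u = 0)
    (c : A[X]) : SemiconjBy (twist (X - 1) q) (unip u v c) (unip (lact q.2 u) (ract q.2 v) c) := by
  obtain ⟨x, hvx, hx, hux, -⟩ := hv.exists_avoid hvu hvu
  rw [unip_eq hℓ hv hx hux hvu hvx, unip_eq hℓ (hv.ract hq) (w := lact q.2 x)
    (by rwa [lact_mem_small_iff hq]) (by rwa [← lact_add, lact_mem_small_iff hq])
    (by rw [ract_dotProduct_lact, hvu]) (by rw [ract_dotProduct_lact, hvx]), ← lact_add]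
  exact (unipReg_semiconjBy hℓ hq hux (by rw [dotProduct_add, hvu, hvx, add_zero]) c).mul_right
    (unipReg_semiconjBy hℓ hq hx hvx c).inv_right

/-- The commutator formula. -/
theorem unip_mul_unip (hℓ : 4 ≤ ℓ + 1) {u₁ u₂ v₁ v₂ w : Fin (ℓ + 1) → A} (hv₁ : Ample v₁)
    (hv₂ : Ample v₂) (hw : w ∉ small ℓ A) (hw₁ : v₁ ⬝ᵥ w = 0) (hw₂ : v₂ ⬝ᵥ w = 0)
    (h₁ : v₁ ⬝ᵥ u₁ = 0) (h₂₁ : v₂ ⬝ᵥ u₁ = 0) (h₂ : v₂ ⬝ᵥ u₂ = 0) (c d : A[X]) :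
    unip u₁ v₁ c * unip u₂ v₂ d =
      unip u₁ v₂ (X * c * d * C (v₁ ⬝ᵥ u₂)) * unip u₂ v₂ d * unip u₁ v₁ c := by
  have key : ∀ {x y : Fin (ℓ + 1) → A}, v₁ ⬝ᵥ x = 0 → v₂ ⬝ᵥ x = 0 → v₂ ⬝ᵥ y = 0 →
      x ∉ small ℓ A → ∀ d, unip x v₁ c * unip y v₂ d =
      unip x v₂ (X * c * d * C (v₁ ⬝ᵥ y)) * unip y v₂ d * unip x v₁ c := by
    intro x y h₁ h₂₁ h₂ hx d
    -- Independent columns fit into a common frame; a dependent `y` is then treated by dividing the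
    -- formula for y + z by the one for z.
    have key' : ∀ {z : Fin (ℓ + 1) → A}, v₂ ⬝ᵥ z = 0 → Indep x z →
        unip x v₁ c * unip z v₂ d =
        unip x v₂ (X * c * d * C (v₁ ⬝ᵥ z)) * unip z v₂ d * unip x v₁ c := by
      intro z hz h
      simp only [unip_of_notMem hx, unip_of_notMem h.right]
      exact h.unipReg_mul hℓ h₁ h₂₁ hz c d
    by_cases h : Indep x y
    · exact key' h₂ h
    · obtain ⟨z, hz, hxz⟩ := hv₂.exists_indep hx
      have e1 := key' (by rw [dotProduct_add, h₂, hz, add_zero]) (hxz.add_of_not_indep h)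
      have e2 := key' hz hxz
      rw [unip_add hℓ hv₂ h₂ hz, dotProduct_add, C_add, mul_add, unip_add_right hℓ hv₂ h₂₁] at e1
      have hc := unip_commute hℓ hv₂ h₂₁ h₂ (X * c * d * C (v₁ ⬝ᵥ z)) d
      apply mul_right_cancel (b := unip z v₂ d)
      rw [mul_assoc, e1, mul_assoc _ (unip x v₁ c), e2]
      generalize unip x v₂ (X * c * d * C (v₁ ⬝ᵥ z)) = g at *
      generalize unip x v₂ (X * c * d * C (v₁ ⬝ᵥ y)) = g' at *
      simp only [mul_assoc]
      rw [← mul_assoc (unip y v₂ d) g, ← hc.eq]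
      simp only [mul_assoc]
  by_cases hu : u₁ ∈ small ℓ A
  · have huw : u₁ + w ∉ small ℓ A := add_notMem hu hw
    have h1 : v₁ ⬝ᵥ (u₁ + w) = 0 := by rw [dotProduct_add, h₁, hw₁, add_zero]
    have h21 : v₂ ⬝ᵥ (u₁ + w) = 0 := by rw [dotProduct_add, h₂₁, hw₂, add_zero]
    have e1 := key h1 h21 h₂ huw d
    have e2 := key hw₁ hw₂ h₂ hw d
    have key' : ∀ {x : Fin (ℓ + 1) → A}, v₁ ⬝ᵥ x = 0 → v₂ ⬝ᵥ x = 0 → x ∉ small ℓ A → ∀ d,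
        Commute (unip x v₁ c) (unip w v₂ d) := by
      intro x h h' hx d
      have := key h h' hw₂ hx d
      rwa [hw₁, C_0, mul_zero, unip_zero hℓ hv₂ h', one_mul] at this
    have e3 : ∀ d, Commute (unip u₁ v₁ c) (unip w v₂ d) := by
      intro d
      have h3 := (key' h1 h21 huw d).mul_left (key' hw₁ hw₂ hw d).inv_left
      rwa [unip_add hℓ hv₁ h₁ hw₁, mul_inv_cancel_right] at h3
    rw [unip_add hℓ hv₁ h₁ hw₁, unip_add hℓ hv₂ h₂₁ hw₂, mul_assoc, e2] at e1
    have hc := unip_commute hℓ hv₂ h₂₁ hw₂ (X * c * d * C (v₁ ⬝ᵥ u₂)) (X * c * d * C (v₁ ⬝ᵥ u₂))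
    have e4 := e3 (X * c * d * C (v₁ ⬝ᵥ u₂))
    rw [← mul_assoc, ← mul_assoc, ← mul_assoc, e4.eq, hc.eq] at e1
    have e5 := mul_right_cancel e1
    simp only [mul_assoc] at e5 ⊢
    exact mul_left_cancel e5
  · exact key h₁ h₂₁ h₂ hu d

/-- Additivity in the row is known for u + w and w. Dividing requires that the lifts for (w, v₁) and
(u, v₂) commute, which is the commutator formula with coefficient v₁ · u = 0. -/
theorem unip_row_add (hℓ : 4 ≤ ℓ + 1) {u v₁ v₂ w : Fin (ℓ + 1) → A} (hv₁ : Ample v₁)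
    (hv₂ : Ample v₂) (hv : Ample (v₁ + v₂)) (hw : w ∉ small ℓ A) (hw₁ : v₁ ⬝ᵥ w = 0)
    (hw₂ : v₂ ⬝ᵥ w = 0) (h₁ : v₁ ⬝ᵥ u = 0) (h₂ : v₂ ⬝ᵥ u = 0) (c : A[X]) :
    unip u (v₁ + v₂) c = unip u v₁ c * unip u v₂ c := by
  by_cases hu : u ∈ small ℓ A
  · have huw := add_notMem hu hw
    have hc := unip_mul_unip hℓ hv₁ hv₂ hw hw₁ hw₂ hw₁ hw₂ h₂ c c
    rw [h₁, C_0, mul_zero, unip_zero hℓ hv₂ hw₂, one_mul, unip_of_notMem hw] at hc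
    apply mul_right_cancel (b := unipReg w (v₁ + v₂) c)
    rw [unip_mul_unipReg hℓ hv hw huw (by rw [add_dotProduct, h₁, h₂, add_zero])
      (by rw [add_dotProduct, hw₁, hw₂, add_zero]), unipReg_row_add hℓ hw hw₁ hw₂,
      unipReg_row_add hℓ huw (by rw [dotProduct_add, h₁, hw₁, add_zero])
      (by rw [dotProduct_add, h₂, hw₂, add_zero]), ← unip_mul_unipReg hℓ hv₁ hw huw h₁ hw₁,
      ← unip_mul_unipReg hℓ hv₂ hw huw h₂ hw₂, mul_assoc, ← mul_assoc (unipReg w v₁ c), hc]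
    simp only [mul_assoc]
  · simp only [unip_of_notMem hu]
    exact unipReg_row_add hℓ hu h₁ h₂ c

end General

/-! ### Lifts attached to the frames of invertible constant matrices -/

section Frames

open Polynomial IsLocalRing

variable {ℓ : ℕ} {A : Type*} [CommRing A]

theorem ract_bas_dotProduct (g : Mat ℓ A) (i j : Fin (ℓ + 1)) :
    ract g (bas j) ⬝ᵥ lact g (bas i) = if i = j then 1 else 0 := by
  rw [ract_dotProduct_lact]
  simp [Pi.single_apply]

theorem ract_bas_dotProduct_of_ne (g : Mat ℓ A) {i j : Fin (ℓ + 1)} (h : i ≠ j) :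
    ract g (bas j) ⬝ᵥ lact g (bas i) = 0 := by
  rw [ract_bas_dotProduct, if_neg h]

theorem lact_apply_mem (m : Mat ℓ A) {I : Ideal A} {u : Fin (ℓ + 1) → A} (hu : ∀ j, u j ∈ I)
    (i : Fin (ℓ + 1)) : lact m u i ∈ I := by
  rw [lact, Matrix.mulVec, dotProduct]
  exact I.sum_mem fun j _ => I.mul_mem_left _ (hu j)

theorem lact_mul_el_of_ne (g : Mat ℓ A) {i j k : Fin (ℓ + 1)} (hij : i ≠ j) (a : A) (hk : k ≠ j) :
    lact (g * el hij a) (bas k) = lact g (bas k) := by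
  rw [lact_mul, lact_el]
  simp [Ne.symm hk]

theorem ract_mul_el_of_ne (g : Mat ℓ A) {i j k : Fin (ℓ + 1)} (hij : i ≠ j) (a : A) (hk : k ≠ i) :
    ract (g * el hij a) (bas k) = ract g (bas k) := by
  rw [ract_mul, ract_el]
  simp [Ne.symm hk]

theorem divX_mul_add (c : A[X]) (a : A) : divX (c * X + C a) = c := by
  ext n
  rw [coeff_divX]
  simp

/-- The first two summands are the effects of changing frames, the third is the commutator term; its
factor `C 1` matches the shape of `frameUnip_mul`. -/
theorem divX_mul_eq (f h : A[X]) : divX (f * h) = divX f * C (h.coeff 0) +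
    divX h * C (f.coeff 0) + X * divX f * divX h * C 1 := by
  conv_lhs => rw [← divX_mul_X_add f, ← divX_mul_X_add h]
  rw [← divX_mul_add (divX f * C (h.coeff 0) + divX h * C (f.coeff 0) + X * divX f * divX h * C 1)
    (f.coeff 0 * h.coeff 0)]
  congr 1
  simp only [C_mul, C_1]
  ring

variable [IsLocalRing A]

theorem exists_lact_inv_bas_apply_notMem (g : Mat ℓ A) :
    ∃ k, lact g⁻¹ (bas 0) k ∉ maximalIdeal A := by
  by_contra h
  push Not at h
  have := lact_apply_mem g h 0
  rw [lact_lact_inv] at this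
  simp at this

/-- Suppose a g e_i + b g e_j ≡ t e_0 modulo the maximal ideal. Applying g⁻¹ and reading entry k
makes t times a unit vanish there, so t, and then a and b, lie in the ideal. -/
theorem indep_lact_bas {g : Mat ℓ A} {i j k : Fin (ℓ + 1)} (hk : lact g⁻¹ (bas 0) k ∉ maximalIdeal A)
    (hi : i ≠ k) (hj : j ≠ k) (hij : i ≠ j) : Indep (lact g (bas i)) (lact g (bas j)) := by
  intro a b hab
  rw [← lact_smul, ← lact_smul, ← lact_add] at hab
  set y : Fin (ℓ + 1) → A := a • bas i + b • bas j with hy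
  set z := lact g y with hz
  have h1 : ∀ l, (z - z 0 • bas 0 : Fin (ℓ + 1) → A) l ∈ maximalIdeal A := by
    intro l
    by_cases hl : l = 0
    · subst hl; simp
    · simpa [hl] using hab l hl
  have h2 : ∀ l, (y - z 0 • lact g⁻¹ (bas 0) : Fin (ℓ + 1) → A) l ∈ maximalIdeal A := by
    have : y - z 0 • lact g⁻¹ (bas 0) = lact g⁻¹ (z - z 0 • bas 0) := by
      have e : z = (z - z 0 • bas 0) + z 0 • bas 0 := by abel
      rw [eq_comm, ← sub_eq_zero, sub_sub_eq_add_sub, ← lact_smul, ← lact_add, ← e, hz,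
        lact_inv_lact, sub_self]
    rw [this]
    exact lact_apply_mem _ h1
  have h3 : z 0 ∈ maximalIdeal A := by
    have h4 := h2 k
    have h5 : y k = 0 := by simp [hy, Ne.symm hi, Ne.symm hj]
    rw [Pi.sub_apply, h5, zero_sub, neg_mem_iff] at h4
    exact ((maximalIdeal.isMaximal A).isPrime.mem_or_mem h4).resolve_right hk
  have h6 : ∀ l, y l ∈ maximalIdeal A := fun l => by
    have h7 : (z 0 • lact g⁻¹ (bas 0)) l ∈ maximalIdeal A := Ideal.mul_mem_right _ _ h3
    simpa using add_mem (h2 l) h7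
  exact ⟨by simpa [hy, hij] using h6 i, by simpa [hy, Ne.symm hij] using h6 j⟩

/-- Omit the index j for orthogonality and k for independence modulo e_0; two indices remain. -/
theorem ample_ract_bas (hℓ : 4 ≤ ℓ + 1) (g : Mat ℓ A) (j : Fin (ℓ + 1)) :
    Ample (ract g (bas j)) := by
  obtain ⟨k, hk⟩ := exists_lact_inv_bas_apply_notMem g
  obtain ⟨i, hik, hij, -⟩ := exists_ne_ne_ne hℓ k j j
  obtain ⟨l, hlk, hlj, hli⟩ := exists_ne_ne_ne hℓ k j i
  exact ⟨_, _, ract_bas_dotProduct_of_ne g hij, ract_bas_dotProduct_of_ne g hlj,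
    indep_lact_bas hk hik hlk (Ne.symm hli)⟩

theorem exists_notMem_small_ract_bas (hℓ : 4 ≤ ℓ + 1) (g : Mat ℓ A) (j k : Fin (ℓ + 1)) :
    ∃ w, w ∉ small ℓ A ∧ ract g (bas j) ⬝ᵥ w = 0 ∧ ract g (bas k) ⬝ᵥ w = 0 := by
  obtain ⟨l, hl⟩ := exists_lact_inv_bas_apply_notMem g
  obtain ⟨i, hil, hij, hik⟩ := exists_ne_ne_ne hℓ l j k
  obtain ⟨m, hml, hmi, -⟩ := exists_ne_ne_ne hℓ l i i
  exact ⟨_, (indep_lact_bas hl hil hml (Ne.symm hmi)).left, ract_bas_dotProduct_of_ne g hij,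
    ract_bas_dotProduct_of_ne g hik⟩

/-- The lift attached to the pair of indices `(i, j)` in the frame given by `g`. -/
def frameUnip (g : Mat ℓ A) (i j : Fin (ℓ + 1)) (c : A[X]) : Steinberg ℓ A[X] :=
  unip (lact g (bas i)) (ract g (bas j)) c

theorem frameUnip_add (hℓ : 4 ≤ ℓ + 1) (g : Mat ℓ A) {i j : Fin (ℓ + 1)} (hij : i ≠ j)
    (c d : A[X]) : frameUnip g i j (c + d) = frameUnip g i j c * frameUnip g i j d :=
  unip_add_right hℓ (ample_ract_bas hℓ g j) (ract_bas_dotProduct_of_ne g hij) c d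

theorem frameUnip_mul (hℓ : 4 ≤ ℓ + 1) (g : Mat ℓ A) {i j k l : Fin (ℓ + 1)} (hij : i ≠ j)
    (hkl : k ≠ l) (hil : i ≠ l) (c d : A[X]) : frameUnip g i j c * frameUnip g k l d =
      frameUnip g i l (X * c * d * C (if k = j then 1 else 0)) * frameUnip g k l d *
        frameUnip g i j c := by
  obtain ⟨w, hw, hw₁, hw₂⟩ := exists_notMem_small_ract_bas hℓ g j l
  rw [← ract_bas_dotProduct g k j]
  exact unip_mul_unip hℓ (ample_ract_bas hℓ g j) (ample_ract_bas hℓ g l) hw hw₁ hw₂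
    (ract_bas_dotProduct_of_ne g hij) (ract_bas_dotProduct_of_ne g hil)
    (ract_bas_dotProduct_of_ne g hkl) c d

theorem frameUnip_commute (hℓ : 4 ≤ ℓ + 1) (g : Mat ℓ A) {i j k l : Fin (ℓ + 1)} (hij : i ≠ j)
    (hkl : k ≠ l) (hil : i ≠ l) (hjk : j ≠ k) (c d : A[X]) :
    Commute (frameUnip g i j c) (frameUnip g k l d) := by
  have h := frameUnip_mul hℓ g hij hkl hil c d
  have h0 : frameUnip g i l 0 = 1 :=
    unip_zero hℓ (ample_ract_bas hℓ g l) (ract_bas_dotProduct_of_ne g hil)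
  rwa [if_neg (Ne.symm hjk), C_0, mul_zero, h0, one_mul] at h

theorem frameUnip_mul_el (g : Mat ℓ A) {i j k l : Fin (ℓ + 1)} (hij : i ≠ j) (a : A) (hk : k ≠ j)
    (hl : l ≠ i) (c : A[X]) : frameUnip (g * el hij a) k l c = frameUnip g k l c := by
  rw [frameUnip, frameUnip, lact_mul_el_of_ne g hij a hk, ract_mul_el_of_ne g hij a hl]

theorem frameUnip_mul_el_left (hℓ : 4 ≤ ℓ + 1) (g : Mat ℓ A) {i j k : Fin (ℓ + 1)} (hij : i ≠ j)
    (hjk : j ≠ k) (hik : i ≠ k) (a : A) (c : A[X]) :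
    frameUnip (g * el hij a) j k c = frameUnip g j k c * frameUnip g i k (c * C a) := by
  have h : lact (g * el hij a) (bas j) = lact g (bas j) + a • lact g (bas i) := by
    rw [lact_mul, lact_el, lact_add, lact_smul]
    simp
  have hk := ample_ract_bas hℓ g k
  have hi := ract_bas_dotProduct_of_ne g hik
  rw [frameUnip, h, ract_mul_el_of_ne g hij a (Ne.symm hik),
    unip_add hℓ hk (ract_bas_dotProduct_of_ne g hjk) (by rw [dotProduct_smul, hi, smul_zero]),
    unip_smul hℓ hk hi, frameUnip, frameUnip]

theorem frameUnip_mul_el_right (hℓ : 4 ≤ ℓ + 1) (g : Mat ℓ A) {i j k : Fin (ℓ + 1)} (hij : i ≠ j)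
    (hjk : j ≠ k) (hik : i ≠ k) (b : A) (c : A[X]) :
    frameUnip (g * el hjk b) i j c = frameUnip g i j c * frameUnip g i k (c * C (-b)) := by
  have h : ract (g * el hjk b) (bas j) = ract g (bas j) + (-b) • ract g (bas k) := by
    rw [ract_mul, ract_el, ract_sub, ract_smul, neg_smul, sub_eq_add_neg]
    simp
  have hv := ample_ract_bas hℓ (g * el hjk b) j
  obtain ⟨w, hw, hw₁, hw₂⟩ := exists_notMem_small_ract_bas hℓ g j k
  have hk := ample_ract_bas hℓ g k
  have hi := ract_bas_dotProduct_of_ne g hik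
  rw [h] at hv
  rw [frameUnip, h, lact_mul_el_of_ne g hjk b hik,
    unip_row_add hℓ (ample_ract_bas hℓ g j) (hk.smul _) hv hw hw₁
      (by rw [smul_dotProduct, hw₂, smul_zero]) (ract_bas_dotProduct_of_ne g hij)
      (by rw [smul_dotProduct, hi, smul_zero]), unip_row_smul hℓ hk hi, frameUnip, frameUnip]

/-- The main relation between the lifts in different frames. -/
theorem frameUnip_mul_frameUnip (hℓ : 4 ≤ ℓ + 1) (g : Mat ℓ A) {i j k : Fin (ℓ + 1)} (hij : i ≠ j)
    (hjk : j ≠ k) (hik : i ≠ k) (f h : A[X]) :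
    frameUnip g i j (divX f) * frameUnip (g * el hij (f.coeff 0)) j k (divX h) =
      frameUnip g i k (divX (f * h)) * frameUnip (g * el hik ((f * h).coeff 0)) j k (divX h) *
        frameUnip (g * el hik ((f * h).coeff 0) * el hjk (h.coeff 0)) i j (divX f) := by
  -- Everything is rewritten in the frame `g`; what remains is a computation with the pairs (i, j),
  -- (j, k) and (i, k), the last commuting with the other two.
  rw [frameUnip_mul_el_left hℓ g hij hjk hik, frameUnip_mul_el g hik _ hjk (Ne.symm hik),
    frameUnip_mul_el_right hℓ _ hij hjk hik, frameUnip_mul_el g hik _ hik (Ne.symm hij),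
    frameUnip_mul_el g hik _ hik (Ne.symm hik), divX_mul_eq]
  have h1 := frameUnip_mul hℓ g hij hjk hik (divX f) (divX h)
  rw [if_pos rfl] at h1
  have h2 (c : A[X]) := frameUnip_commute hℓ g hik hij hij (Ne.symm hik) c (divX f)
  have h3 (c : A[X]) := frameUnip_commute hℓ g hik hjk hik (Ne.symm hjk) c (divX h)
  generalize frameUnip g i j (divX f) = y at *
  generalize frameUnip g j k (divX h) = z at *
  have h4 : divX f * C (h.coeff 0) + divX h * C (f.coeff 0) + X * divX f * divX h * C 1 =
      (X * divX f * divX h * C 1 + divX h * C (f.coeff 0)) + divX f * C (h.coeff 0) := by ring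
  have h5 : frameUnip g i k (divX f * C (h.coeff 0)) * frameUnip g i k (divX f * C (-h.coeff 0)) =
      1 := by
    rw [← frameUnip_add hℓ g hik, ← mul_add, ← C_add, add_neg_cancel, C_0, mul_zero]
    exact unip_zero hℓ (ample_ract_bas hℓ g k) (ract_bas_dotProduct_of_ne g hik)
  rw [h4, frameUnip_add hℓ g hik, ← (h2 _).eq, frameUnip_add hℓ g hik, ← mul_assoc, h1]
  calc _ = frameUnip g i k (X * divX f * divX h * C 1) *
        (frameUnip g i k (divX h * C (f.coeff 0)) * (z * y)) := by
        rw [((h3 _).mul_right (h2 _)).eq]; simp only [mul_assoc]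
    _ = frameUnip g i k (X * divX f * divX h * C 1) *
        (frameUnip g i k (divX h * C (f.coeff 0)) * ((frameUnip g i k (divX f * C (h.coeff 0)) *
          frameUnip g i k (divX f * C (-h.coeff 0))) * (z * y))) := by rw [h5, one_mul]
    _ = _ := by
        rw [mul_assoc (frameUnip g i k (divX f * C (h.coeff 0))), ← mul_assoc _ z y, (h3 _).eq]
        simp only [mul_assoc]

end Frames

/-! ### Assembling all frames into one homomorphism -/

section Wreath

open Polynomial IsLocalRing

variable {ℓ : ℕ} {A : Type*} [CommRing A]

/-- Matrices acting on functions on matrices by right translation of the argument. -/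
def translation (ℓ : ℕ) (A : Type*) [CommRing A] :
    Mat ℓ A →* MulAut (Mat ℓ A → Steinberg ℓ A[X]) where
  toFun m :=
    { toFun := fun F g => F (g * m)
      invFun := fun F g => F (g * m⁻¹)
      left_inv := fun F => by ext1 g; simp
      right_inv := fun F => by ext1 g; simp
      map_mul' := fun _ _ => rfl }
  map_one' := by ext F g; simp
  map_mul' m n := by ext F g; simp [mul_assoc]

/-- The functions on matrices with values in the Steinberg group, extended by the matrices. -/
abbrev Wreath (ℓ : ℕ) (A : Type*) [CommRing A] : Type _ :=
  (Mat ℓ A → Steinberg ℓ A[X]) ⋊[translation ℓ A] Mat ℓ A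

theorem wreath_mul_left (x y : Wreath ℓ A) (g : Mat ℓ A) :
    (x * y).left g = x.left g * y.left (g * x.right) := rfl

/-- The elementary matrix, with value `1` for `i = j`. -/
def elMat (i j : Fin (ℓ + 1)) (a : A) : Mat ℓ A := if h : i ≠ j then el h a else 1

theorem elMat_of_ne {i j : Fin (ℓ + 1)} (h : i ≠ j) (a : A) : elMat i j a = el h a := dif_pos h

theorem el_mul_el {i j : Fin (ℓ + 1)} (h : i ≠ j) (a b : A) :
    el h a * el h b = el h (a + b) := by
  refine mat_ext fun u => ?_
  simp only [lact_mul, lact_el]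
  ext k
  simp [Ne.symm h]
  ring

theorem el_mul_el_of_eq {i j k : Fin (ℓ + 1)} (hij : i ≠ j) (hjk : j ≠ k) (hik : i ≠ k) (a b : A) :
    el hij a * el hjk b = el hik (a * b) * el hjk b * el hij a := by
  refine mat_ext fun u => ?_
  simp only [lact_mul, lact_el]
  ext m
  simp [Ne.symm hjk, Ne.symm hik]
  ring

theorem el_mul_el_comm {i j k l : Fin (ℓ + 1)} (hij : i ≠ j) (hkl : k ≠ l) (hjk : j ≠ k)
    (hil : i ≠ l) (a b : A) : el hij a * el hkl b = el hkl b * el hij a := by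
  refine mat_ext fun u => ?_
  simp only [lact_mul, lact_el]
  ext m
  simp [hjk, Ne.symm hil]
  ring

/-- The endomorphism of the Steinberg group given by evaluation at `X = 0`. -/
def constTerm : Steinberg ℓ A[X] →* Steinberg ℓ A[X] :=
  liftElem (fun i j f => elem i j (C (f.coeff 0)))
    (fun i j a b _ => by rw [elem_mul, coeff_add, C_add])
    (fun i j k a b hij hjk hik => by rw [mul_coeff_zero, C_mul, elem_mul_elem hij hjk hik])
    (fun i j k l a b _ _ hjk hil => elem_commute hjk hil _ _)

/-- The contragredient automorphism of the Steinberg group. -/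
def contra {R : Type*} [CommRing R] : Steinberg ℓ R →* Steinberg ℓ R :=
  liftElem (fun i j a => elem j i (-a))
    (fun i j a b _ => by rw [elem_mul, neg_add])
    (fun i j k a b hij hjk hik => by
      have h := elem_mul_elem (Ne.symm hjk) (Ne.symm hij) (Ne.symm hik) (-b) (-a)
      have hc1 := elem_commute hik hij (b * a) (-a)
      have hc2 := elem_commute hjk hik (-b) (b * a)
      rw [neg_mul_neg] at h
      rw [mul_comm a b, elem_neg k i (b * a), mul_assoc, h, mul_assoc, inv_mul_cancel_left])
    (fun i j k l a b _ _ hjk hil => elem_commute hil hjk _ _)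

theorem contra_elem {R : Type*} [CommRing R] {i j : Fin (ℓ + 1)} (h : i ≠ j) (a : R) :
    contra (elem i j a) = elem j i (-a) := liftElem_elem _ _ _ h a

theorem constTerm_elem {i j : Fin (ℓ + 1)} (h : i ≠ j) (f : A[X]) :
    constTerm (elem i j f) = elem i j (C (f.coeff 0)) := liftElem_elem _ _ _ h f

variable [IsLocalRing A]

/-- The homomorphism from the Steinberg group which records the lifts in all frames. -/
def frameHom (hℓ : 4 ≤ ℓ + 1) : Steinberg ℓ A[X] →* Wreath ℓ A :=
  liftElem (fun i j f => ⟨fun g => frameUnip g i j (divX f), elMat i j (f.coeff 0)⟩)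
    (fun i j a b h => by
      simp only [elMat_of_ne h]
      refine SemidirectProduct.ext (funext fun g => ?_) ?_
      · rw [wreath_mul_left]
        dsimp only
        rw [frameUnip_mul_el g h _ h (Ne.symm h), divX_add, frameUnip_add hℓ g h]
      · rw [SemidirectProduct.mul_right, el_mul_el, coeff_add])
    (fun i j k a b hij hjk hik => by
      simp only [elMat_of_ne hij, elMat_of_ne hjk, elMat_of_ne hik]
      refine SemidirectProduct.ext (funext fun g => ?_) ?_
      · simp only [wreath_mul_left, SemidirectProduct.mul_right, ← mul_assoc g]
        exact frameUnip_mul_frameUnip hℓ g hij hjk hik a b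
      · simp only [SemidirectProduct.mul_right]
        rw [mul_coeff_zero, el_mul_el_of_eq])
    (fun i j k l a b hij hkl hjk hil => by
      simp only [elMat_of_ne hij, elMat_of_ne hkl]
      refine SemidirectProduct.ext (funext fun g => ?_) ?_
      · simp only [wreath_mul_left]
        rw [frameUnip_mul_el g hij _ (Ne.symm hjk) (Ne.symm hil), frameUnip_mul_el g hkl _ hil hjk]
        exact frameUnip_commute hℓ g hij hkl hil hjk _ _
      · simp only [SemidirectProduct.mul_right]
        exact el_mul_el_comm hij hkl hjk hil _ _)

theorem frameHom_elem (hℓ : 4 ≤ ℓ + 1) {i j : Fin (ℓ + 1)} (h : i ≠ j) (f : A[X]) :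
    frameHom hℓ (elem i j f) = ⟨fun g => frameUnip g i j (divX f), el h (f.coeff 0)⟩ := by
  rw [frameHom, liftElem_elem _ _ _ h, elMat_of_ne h]

/-- Left multiplication of the frame by p moves each u to p u and each v to v p⁻¹, which
`unip_semiconjBy` realizes by conjugation; the semidirect product translates on the right, so the
two are compatible. -/
theorem frameHom_left_mul (hℓ : 4 ≤ ℓ + 1) (y : Steinberg ℓ A[X])
    {p : Steinberg ℓ A[X] × Mat ℓ A} (hp : p ∈ levGroup ℓ A) (g : Mat ℓ A) :
    SemiconjBy (twist (X - 1) p) ((frameHom hℓ y).left g) ((frameHom hℓ y).left (p.2 * g)) := by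
  have hy : y ∈ (⊤ : Subgroup (Steinberg ℓ A[X])) := trivial
  rw [← closure_elem] at hy
  induction hy using Subgroup.closure_induction generalizing g with
  | mem y hy =>
    obtain ⟨i, j, f, hij, rfl⟩ := hy
    rw [frameHom_elem hℓ hij]
    dsimp only
    rw [frameUnip, frameUnip, lact_mul, ract_mul]
    exact unip_semiconjBy hℓ hp (ample_ract_bas hℓ g j) (ract_bas_dotProduct_of_ne g hij) _
  | one =>
    rw [map_one]
    exact SemiconjBy.one_right _
  | mul y z _ _ hy hz =>
    rw [map_mul, wreath_mul_left, wreath_mul_left, mul_assoc]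
    exact (hy g).mul_right (hz _)
  | inv y _ hy =>
    have h (g : Mat ℓ A) : (frameHom hℓ y⁻¹).left g =
        ((frameHom hℓ y).left (g * (frameHom hℓ y⁻¹).right))⁻¹ := by
      rw [eq_inv_iff_mul_eq_one, ← wreath_mul_left, ← map_mul, inv_mul_cancel, map_one]
      rfl
    rw [h, h, mul_assoc]
    exact (hy _).inv_right

end Wreath

/-! ### Weights, shifts, and reduction to one homomorphism -/

section Weights

variable {ℓ : ℕ}

theorem pairing_neg (ω : weightLattice ℓ) (α : Root ℓ) : pairing (-ω) α = -pairing ω α := by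
  have h1 := pairing_spec (-ω) α
  have h2 := pairing_spec ω α
  rw [inner_covec] at h1 h2
  have h3 : ((pairing (-ω) α : ℤ) : ℝ) = ((-pairing ω α : ℤ) : ℝ) := by
    push_cast
    rw [h1, h2]
    simp
    ring
  exact_mod_cast h3

/-- The opposite root. -/
def Root.swap (α : Root ℓ) : Root ℓ := ⟨α.j, α.i, α.ne.symm⟩

theorem pairing_swap (ω : weightLattice ℓ) (α : Root ℓ) : pairing ω α.swap = -pairing ω α := by
  have h1 := pairing_spec ω α.swap
  have h2 := pairing_spec ω α
  rw [inner_covec] at h1 h2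
  have h3 : ((pairing ω α.swap : ℤ) : ℝ) = ((-pairing ω α : ℤ) : ℝ) := by
    push_cast
    rw [h1, h2, Root.swap]
    ring
  exact_mod_cast h3

theorem pairing_fundamentalWeight_zero (h : 0 < ℓ) (α : Root ℓ) :
    pairing (fundamentalWeight ⟨0, h⟩) α =
      (if α.i = 0 then 1 else 0) - (if α.j = 0 then 1 else 0) := by
  have h1 := pairing_spec (fundamentalWeight ⟨0, h⟩) α
  rw [inner_covec] at h1
  have h3 : ((pairing (fundamentalWeight ⟨0, h⟩) α : ℤ) : ℝ) =
      (((if α.i = 0 then 1 else 0) - (if α.j = 0 then 1 else 0) : ℤ) : ℝ) := by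
    rw [h1]
    simp [fundamentalWeight, fundamentalWeightVec]
  exact_mod_cast h3

variable {A : Type*} [CommRing A]

theorem shift_neg_shift {p : ℤ} {f : A[X]} (h : p < 0 → Polynomial.X ^ (-p).toNat ∣ f) :
    shift (-p) (shift p f) = f := by
  apply Polynomial.toLaurent_injective
  rw [toLaurent_shift, toLaurent_shift p f h, ← mul_assoc, ← LaurentPolynomial.T_add,
    neg_add_cancel, LaurentPolynomial.T_zero, one_mul]
  intro hp
  have h0 : (-p).toNat = 0 := by omega
  rw [neg_neg, shift, h0, pow_zero, Polynomial.divByMonic_one]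
  exact dvd_mul_right _ _

theorem shift_neg {p : ℤ} {f : A[X]} (h : p < 0 → Polynomial.X ^ (-p).toNat ∣ f) :
    shift p (-f) = -shift p f := by
  apply Polynomial.toLaurent_injective
  rw [toLaurent_shift p _ fun hp => (dvd_neg).mpr (h hp), map_neg, map_neg, toLaurent_shift p f h,
    mul_neg]

theorem shift_zero (f : A[X]) : shift 0 f = f := by
  simp [shift]

theorem shift_one (f : A[X]) : shift 1 f = Polynomial.X * f := by
  simp [shift]

theorem shift_neg_one_X_mul (c : A[X]) : shift (-1) (Polynomial.X * c) = c := by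
  rw [← shift_one]
  exact shift_neg_shift (p := 1) (by omega)

theorem Admissible.shift {ω : weightLattice ℓ} {α : Root ℓ} (f : A[X]) :
    Admissible (-ω) α (TypeA.shift (pairing ω α) f) := by
  intro h
  rw [pairing_neg] at h
  have h0 : (-pairing ω α).toNat = 0 := by omega
  rw [pairing_neg, neg_neg, TypeA.shift, h0, pow_zero, Polynomial.divByMonic_one]
  exact dvd_mul_right _ _

theorem Admissible.swap {ω : weightLattice ℓ} {α : Root ℓ} {f : A[X]} (h : Admissible ω α f) :
    Admissible (-ω) α.swap (-f) := by
  rw [Admissible, pairing_neg, pairing_swap, neg_neg]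
  exact fun h' => (dvd_neg).mpr (h h')

theorem contra_x (α : Root ℓ) {R : Type*} [CommRing R] (a : R) :
    contra (Steinberg.x α a) = Steinberg.x α.swap (-a) := by
  rw [x_eq_elem, contra_elem α.ne, x_eq_elem]
  rfl

theorem contra_mem_N {ω : weightLattice ℓ} {y : Steinberg ℓ A[X]} (hy : y ∈ N A (-ω)) :
    contra y ∈ N A ω := by
  have h : N A (-ω) ≤ (N A ω).comap contra := by
    rw [N, Subgroup.closure_le]
    rintro _ ⟨α, f, h, rfl⟩
    rw [SetLike.mem_coe, Subgroup.mem_comap, contra_x]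
    have := h.swap
    rw [neg_neg] at this
    exact x_mem_N this
  exact h hy

theorem closure_generators_N (ω : weightLattice ℓ) :
    Subgroup.closure {y : N A ω | ∃ (α : Root ℓ) (f : A[X]) (hf : Admissible ω α f),
      y = ⟨Steinberg.x α f, x_mem_N hf⟩} = ⊤ := by
  set S := {y : N A ω | ∃ (α : Root ℓ) (f : A[X]) (hf : Admissible ω α f),
      y = ⟨Steinberg.x α f, x_mem_N hf⟩} with hS
  have h : N A ω ≤ (Subgroup.closure S).map (N A ω).subtype := by
    conv_lhs => rw [N]
    rw [Subgroup.closure_le]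
    rintro _ ⟨α, f, hf, rfl⟩
    exact ⟨⟨_, x_mem_N hf⟩, Subgroup.subset_closure ⟨α, f, hf, rfl⟩, rfl⟩
  rw [eq_top_iff]
  intro y _
  obtain ⟨z, hz, e⟩ := h y.2
  rwa [← Subtype.ext e]

theorem N_hom_ext {H : Type*} [Group H] {ω : weightLattice ℓ} {φ ψ : N A ω →* H}
    (h : ∀ (α : Root ℓ) (f : A[X]) (hf : Admissible ω α f),
      φ ⟨Steinberg.x α f, x_mem_N hf⟩ = ψ ⟨Steinberg.x α f, x_mem_N hf⟩) : φ = ψ := by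
  refine MonoidHom.eq_of_eqOn_dense (closure_generators_N ω) ?_
  rintro _ ⟨α, f, hf, rfl⟩
  exact h α f hf

theorem hom_mem_of_generators {H : Type*} [Group H] {ω : weightLattice ℓ} (φ : N A ω →* H)
    (K : Subgroup H) (h : ∀ (α : Root ℓ) (f : A[X]) (hf : Admissible ω α f),
      φ ⟨Steinberg.x α f, x_mem_N hf⟩ ∈ K) (y : N A ω) : φ y ∈ K := by
  have : (⊤ : Subgroup (N A ω)) ≤ K.comap φ := by
    rw [← closure_generators_N ω, Subgroup.closure_le]
    rintro _ ⟨α, f, hf, rfl⟩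
    exact h α f hf
  exact this trivial

/-- A homomorphism on `N_ω` with the values prescribed for `σ(ω)` gives rise to an `ω`-pair. -/
theorem nonempty_weightPair {ω : weightLattice ℓ} (φ : N A ω →* Steinberg ℓ A[X])
    (hφ : ∀ (α : Root ℓ) (f : A[X]) (hf : Admissible ω α f),
      φ ⟨Steinberg.x α f, x_mem_N hf⟩ = Steinberg.x α (shift (pairing ω α) f)) :
    Nonempty (WeightPair A ω) := by
  have hpos : ∀ y, φ y ∈ N A (-ω) := hom_mem_of_generators φ _ fun α f hf => by
    rw [hφ α f hf]; exact x_mem_N (Admissible.shift f)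
  let pos : N A ω →* N A (-ω) := φ.codRestrict _ hpos
  -- The contragredient automorphism replaces α by -α and so interchanges N_ω and N_{-ω};
  -- conjugating `φ` with it gives σ(-ω).
  let flip : N A (-ω) →* N A ω :=
    (contra.comp (N A (-ω)).subtype).codRestrict _ fun y => contra_mem_N y.2
  let negHom : N A (-ω) →* Steinberg ℓ A[X] := contra.comp (φ.comp flip)
  have hneg' : ∀ (α : Root ℓ) (f : A[X]) (hf : Admissible (-ω) α f),
      negHom ⟨Steinberg.x α f, x_mem_N hf⟩ = Steinberg.x α (shift (-pairing ω α) f) := by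
    intro α f hf
    have hf' := hf.swap
    rw [neg_neg] at hf'
    have e : flip ⟨Steinberg.x α f, x_mem_N hf⟩ = ⟨Steinberg.x α.swap (-f), x_mem_N hf'⟩ :=
      Subtype.ext (contra_x α f)
    change contra (φ (flip _)) = _
    rw [e, hφ _ _ hf', contra_x, pairing_swap, ← pairing_neg, shift_neg hf, neg_neg]
    rfl
  have hneg : ∀ y, negHom y ∈ N A ω := hom_mem_of_generators negHom _ fun α f hf => by
    rw [hneg' α f hf, ← pairing_neg]
    have := Admissible.shift (ω := -ω) (α := α) f
    rw [neg_neg] at this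
    exact x_mem_N this
  let neg : N A (-ω) →* N A ω := negHom.codRestrict _ hneg
  have pos_x (α : Root ℓ) (f : A[X]) (hf : Admissible ω α f) : pos ⟨Steinberg.x α f, x_mem_N hf⟩ =
      ⟨Steinberg.x α (shift (pairing ω α) f), x_mem_N (Admissible.shift f)⟩ :=
    Subtype.ext (hφ α f hf)
  refine ⟨⟨pos, neg, fun g => ?_, fun g => ?_, hφ, hneg'⟩⟩
  · have : neg.comp pos = MonoidHom.id _ := N_hom_ext fun α f hf => Subtype.ext <| by
      rw [MonoidHom.comp_apply, pos_x α f hf]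
      change negHom _ = _
      rw [hneg' α _ (Admissible.shift f), shift_neg_shift hf]
      rfl
    exact DFunLike.congr_fun this g
  · have : pos.comp neg = MonoidHom.id _ := N_hom_ext fun α f hf => Subtype.ext <| by
      have h := Admissible.shift (ω := -ω) (α := α) f
      rw [neg_neg] at h
      have e : neg ⟨Steinberg.x α f, x_mem_N hf⟩ =
          ⟨Steinberg.x α (shift (pairing (-ω) α) f), x_mem_N h⟩ :=
        Subtype.ext ((hneg' α f hf).trans
          (congrArg (fun p => Steinberg.x α (shift p f)) (pairing_neg ω α).symm))
      rw [MonoidHom.comp_apply, e, pos_x α _ h]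
      have h2 := shift_neg_shift hf
      rw [pairing_neg, neg_neg] at h2
      change Steinberg.x _ _ = Steinberg.x _ _
      rw [pairing_neg, h2]
    exact DFunLike.congr_fun this g

theorem coeff_zero_of_admissible {ω : weightLattice ℓ}
    (hω : ∀ α, pairing ω α = (if α.i = 0 then 1 else 0) - (if α.j = 0 then 1 else 0))
    {α : Root ℓ} {f : A[X]} (hf : Admissible ω α f) (hα : α.j = 0) : f.coeff 0 = 0 := by
  have hi : α.i ≠ 0 := fun h => α.ne (h.trans hα.symm)
  have h := hω α
  rw [if_neg hi, if_pos hα, zero_sub] at h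
  have := hf (by omega)
  rw [h] at this
  simpa [Polynomial.X_dvd_iff] using this

end Weights

/-! ### The homomorphism for the first fundamental weight -/

section FirstWeight

open Polynomial IsLocalRing

variable {ℓ : ℕ} {A : Type*} [CommRing A] [IsLocalRing A]

theorem frameUnip_one_of_ne_zero {i j : Fin (ℓ + 1)} (hij : i ≠ j) (hi : i ≠ 0) (c : A[X]) :
    frameUnip (1 : Mat ℓ A) i j c = elem i j (if j = 0 then c else X * c) := by
  have h1 : (bas j : Fin (ℓ + 1) → A) ⬝ᵥ lact ((1 : Steinberg ℓ A[X] × Mat ℓ A)).2 (bas i) = 0 := by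
    simp [hij]
  have h2 := unipReg_eq (one_mem (levGroup ℓ A)) hi h1 c
  simp only [Prod.snd_one, lact_one, inv_one, ract_one, twist_one, one_mul, mul_one] at h2
  rw [frameUnip, lact_one, ract_one, unip_of_notMem (bas_notMem_small hi), h2, wrow]
  by_cases hj : j = 0
  · subst hj
    simp [off]
  · rw [if_neg hj, off]
    simp only [Pi.single_eq_of_ne (Ne.symm hj), zero_smul, sub_zero, C_0, mul_zero, elem_zero,
      mul_one, emb_bas, row_single]

/-- The column e_0 is small, so there is no direct formula. The lift for e_k + e_0 is computed
twice: by additivity, and as the conjugate of x_{kj}(Xc) by x_{0k}(X). -/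
theorem frameUnip_one_zero (hℓ : 4 ≤ ℓ + 1) {j : Fin (ℓ + 1)} (hj : j ≠ 0) (c : A[X]) :
    frameUnip (1 : Mat ℓ A) 0 j c = elem 0 j (X * (X * c)) := by
  obtain ⟨k, hk0, hkj, -⟩ := exists_ne_ne_ne hℓ 0 j j
  have h := frameUnip_mul_el_left hℓ (1 : Mat ℓ A) (Ne.symm hk0) hkj (Ne.symm hj) 1 c
  rw [C_1, mul_one] at h
  have hp : (elem 0 k (C (1 : A)), el (Ne.symm hk0) (1 : A)) ∈ levGroup ℓ A :=
    mem_levGroup (Ne.symm hk0) 1 hk0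
  have h2 := unip_semiconjBy hℓ hp (ample_ract_bas hℓ 1 j) (ract_bas_dotProduct_of_ne 1 hkj) c
  rw [← lact_mul, ← ract_mul, mul_one, twist_elem, if_pos rfl] at h2
  change SemiconjBy _ (frameUnip 1 k j c) (frameUnip _ k j c) at h2
  rw [one_mul] at h
  rw [h, frameUnip_one_of_ne_zero hkj hk0, if_neg hj, sub_add_cancel, C_1, mul_one] at h2
  have h3 := h2.eq
  rw [elem_mul_elem (Ne.symm hk0) hkj (Ne.symm hj)] at h3
  have h4 := mul_right_cancel h3
  rw [elem_commute (Ne.symm hkj) (Ne.symm hj)] at h4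
  exact (mul_left_cancel h4).symm

/-- The homomorphism from the Steinberg group to the pairs of its constant terms. -/
def levHom (hℓ : 4 ≤ ℓ + 1) : Steinberg ℓ A[X] →* Steinberg ℓ A[X] × Mat ℓ A :=
  constTerm.prod (SemidirectProduct.rightHom.comp (frameHom hℓ))

theorem levHom_elem (hℓ : 4 ≤ ℓ + 1) {i j : Fin (ℓ + 1)} (h : i ≠ j) (f : A[X]) :
    levHom hℓ (elem i j f) = (elem i j (C (f.coeff 0)), el h (f.coeff 0)) := by
  refine Prod.ext (constTerm_elem h f) ?_
  change (frameHom hℓ (elem i j f)).right = _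
  rw [frameHom_elem hℓ h]

variable {ω : weightLattice ℓ}

/-- For the roots (i, 0) admissibility forces f(0) = 0, so exactly the generators excluded from
`levGroup` become trivial. -/
theorem levHom_mem (hℓ : 4 ≤ ℓ + 1)
    (hω : ∀ α, pairing ω α = (if α.i = 0 then 1 else 0) - (if α.j = 0 then 1 else 0))
    {y : Steinberg ℓ A[X]} (hy : y ∈ N A ω) : levHom hℓ y ∈ levGroup ℓ A := by
  have h : N A ω ≤ (levGroup ℓ A).comap (levHom hℓ) := by
    rw [N, Subgroup.closure_le]
    rintro _ ⟨α, f, hf, rfl⟩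
    rw [SetLike.mem_coe, Subgroup.mem_comap, x_eq_elem, levHom_elem hℓ α.ne]
    by_cases hj : α.j = 0
    · have h0 : el α.ne (0 : A) = 1 := mat_ext fun u => by simp [lact_el]
      rw [coeff_zero_of_admissible hω hf hj, C_0, elem_zero, h0]
      exact one_mem _
    · exact mem_levGroup α.ne _ hj
  exact h hy

/-- The homomorphism `σ(ϖ₁)`. -/
def weightHom (hℓ : 4 ≤ ℓ + 1)
    (hω : ∀ α, pairing ω α = (if α.i = 0 then 1 else 0) - (if α.j = 0 then 1 else 0)) :
    N A ω →* Steinberg ℓ A[X] :=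
  MonoidHom.mk' (fun y => (frameHom hℓ (y : Steinberg ℓ A[X])).left 1 *
    twist (X - 1) (levHom hℓ (y : Steinberg ℓ A[X]))) fun y z => by
      have hy := levHom_mem hℓ hω y.2
      -- In the product the function of `z` is evaluated at the matrix of `y` instead of 1; moving
      -- the twisted constant part of `y` across it restores the value at 1.
      have h := (frameHom_left_mul hℓ (z : Steinberg ℓ A[X]) hy 1).eq
      have h1 : (levHom hℓ (y : Steinberg ℓ A[X])).2 = (frameHom hℓ (y : Steinberg ℓ A[X])).right :=
        rfl
      rw [h1, mul_one] at h
      rw [Subgroup.coe_mul, map_mul, map_mul, wreath_mul_left, one_mul,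
        twist_mul _ hy (levHom_mem hℓ hω z.2), mul_assoc, ← mul_assoc _ (twist _ _) (twist _ _), ← h]
      simp only [mul_assoc]

theorem weightHom_x (hℓ : 4 ≤ ℓ + 1)
    (hω : ∀ α, pairing ω α = (if α.i = 0 then 1 else 0) - (if α.j = 0 then 1 else 0))
    (α : Root ℓ) (f : A[X]) (hf : Admissible ω α f) :
    weightHom hℓ hω ⟨Steinberg.x α f, x_mem_N hf⟩ = Steinberg.x α (shift (pairing ω α) f) := by
  change (frameHom hℓ (Steinberg.x α f)).left 1 *
    twist (X - 1) (levHom hℓ (Steinberg.x α f)) = _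
  have h0 := coeff_zero_of_admissible hω hf
  have hne := α.ne
  rw [hω, x_eq_elem, x_eq_elem, frameHom_elem hℓ hne, levHom_elem hℓ hne, twist_elem]
  dsimp only
  by_cases hi : α.i = 0
  · have hj : α.j ≠ 0 := fun h => hne (hi.trans h.symm)
    -- The two factors are x_{0j}(X · X divX f) and x_{0j}(X f(0)), with product x_{0j}(X f).
    rw [if_pos hi, if_pos hi, if_neg hj, sub_add_cancel, sub_zero, shift_one, hi,
      frameUnip_one_zero hℓ hj, elem_mul, ← mul_add, X_mul_divX_add]
  · rw [if_neg hi, if_neg hi, frameUnip_one_of_ne_zero hne hi]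
    by_cases hj : α.j = 0
    · have hX := X_mul_divX_add f
      rw [h0 hj, C_0, add_zero] at hX
      rw [if_pos hj, if_pos hj, h0 hj, C_0, elem_zero, mul_one, zero_sub]
      conv_rhs => rw [← hX]
      rw [shift_neg_one_X_mul]
    · rw [if_neg hj, if_neg hj, elem_mul, X_mul_divX_add, sub_zero, shift_zero]

end FirstWeight

end TypeA

end

theorem mainTheorem8 {A : Type*} [CommRing A] [IsLocalRing A] (ℓ : ℕ) (hℓ : 4 ≤ ℓ + 1) :
    Nonempty (TypeA.WeightPair A
      (TypeA.fundamentalWeight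
        (⟨0, Nat.lt_of_lt_of_le (Nat.succ_pos 2) (Nat.le_of_succ_le_succ hℓ)⟩ : Fin ℓ))) :=
  TypeA.nonempty_weightPair
    (TypeA.weightHom hℓ (TypeA.pairing_fundamentalWeight_zero _))
    (TypeA.weightHom_x hℓ (TypeA.pairing_fundamentalWeight_zero _))
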